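/- Let $\varphi\in\mathbb R$ be such that $q=e^{i\varphi}$ is not a root of unity, and put $q^{1/2}=e^{i\varphi/2}$. Let $\mathcal A=SL_q(2,\mathbb R)$ be the unital complex $*$-algebra generated by four self-adjoint elements $a,b,c,d$ with relations $$ab=q\,ba,\quad ac=q\,ca,\quad bc=cb,\quad bd=q\,db,\quad cd=q\,dc,\quad da-q^{-1}bc=1=ad-q\,bc,$$ with the Hopf algebra structure $$\Delta\begin{pmatrix}a&b\\c&d\end{pmatrix}=\begin{pmatrix}a&b\\c&d\end{pmatrix}\otimes\begin{pmatrix}a&b\\c&d\end{pmatrix},\quad \varepsilon\begin{pmatrix}a&b\\c&d\end{pmatrix}=\begin{pmatrix}1&0\\0&1\end{pmatrix},\quad S\begin{pmatrix}a&b\\c&d\end{pmatrix}=\begin{pmatrix}d&-q^{-1}b\\-q\,c&a\end{pmatrix},$$ and let $\tau=*\circ S$. For $\mu,\nu\in\mathbb R$ let $\mathcal C_{\mu\nu}$ be the linear span of $a-d+2q^{1/2}\mu\,b$ and $q\nu\,b+c$, let $\mathcal R_{\mu\nu}=\mathcal C_{\mu\nu}\mathcal A$ be the right ideal it generates (it is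 a $\tau$-invariant two-sided coideal), and let $\mathcal K_{\mu\nu}=\mathcal A/\mathcal R_{\mu\nu}$, with the induced coalgebra structure, right $\mathcal A$-module structure and antilinear map $\tau$. Let $\mathbf R_+$ and $\mathbf S^1$ denote the coalgebra $\mathbb C[z,z^{-1}]$ with all $z^n$ ($n\in\mathbb Z$) group-like, $S(z)=z^{-1}$, and the antilinear map $\tau=*\circ S$, where $z^*=z$ for $\mathbf R_+$ and $z^*=z^{-1}$ for $\mathbf S^1$ (so $\tau(z^n)=z^{-n}$, respectively $\tau(z^n)=z^n$). An isomorphism of real coalgebras is a complex coalgebra isomorphism that intertwines the maps $\tau$. Then: (i) If $\mu^2>\nu$, then $\mathcal K_{\mu\nu}$ is isomorphic to $\mathbf R_+$ as a real coalgebra. If $\nu>0$ and $\mu/\sqrt\nu=\cos\varphi_{\mu\nu}$ for a real $\varphi_{\mu\nu}$ with $\cos^2\varphi_{\mu\nu}\neq\cos^2(\ell\varphi)$ for all $\ell\in\mathbb Z$, then $\mathcal K_{\mu\nu}$ is isomorphic to $\mathbf S^1$ as a real coalgebra. Any two members of the special series, that is, any two $\mathcal K_{\mu\nu}$, $\mathcal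 K_{\mu'\nu'}$ with $\nu,\nu'>0$, $\mu/\sqrt\nu=\cos\varphi_{\mu\nu}$, $\mu'/\sqrt{\nu'}=\cos\varphi_{\mu'\nu'}$, $\cos^2\varphi_{\mu\nu}=\cos^2(\ell\varphi)$ and $\cos^2\varphi_{\mu'\nu'}=\cos^2(\ell'\varphi)$ for some $\ell,\ell'\in\mathbb Z$, are isomorphic as real coalgebras. (ii) If $\nu>0$, $\mu/\sqrt\nu=\cos\varphi_{\mu\nu}$ with $\varphi_{\mu\nu}\in\mathbb R$, $n\in\mathbb Z$ and $\mu_n/\sqrt\nu=\cos(\varphi_{\mu\nu}+n\varphi)$, then there is a linear isomorphism $\mathcal K_{\mu\nu}\to\mathcal K_{\mu_n\nu}$ that is at once an isomorphism of real coalgebras and of right $\mathcal A$-modules. -/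

import Mathlib

open scoped TensorProduct LaurentPolynomial ComplexConjugate

noncomputable section

namespace QuantumSL2

/-- The deformation parameter `q = e^{iφ}`, of modulus one. -/
def q (φ : ℝ) : ℂ := Complex.exp (φ * Complex.I)

/-- The square root `q^{1/2} = e^{iφ/2}` (replacing `φ` by `φ + 2π` gives the other root). -/
def qHalf (φ : ℝ) : ℂ := Complex.exp ((φ / 2 : ℝ) * Complex.I)

theorem q_ne_zero (φ : ℝ) : q φ ≠ 0 := Complex.exp_ne_zero _

theorem conj_q (φ : ℝ) : conj (q φ) = (q φ)⁻¹ := by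
  rw [q, ← Complex.exp_conj, ← Complex.exp_neg]; simp

theorem conj_q_inv (φ : ℝ) : conj ((q φ)⁻¹) = q φ := by
  rw [map_inv₀, conj_q, inv_inv]

theorem conj_qHalf (φ : ℝ) : conj (qHalf φ) = (qHalf φ)⁻¹ := by
  rw [qHalf, ← Complex.exp_conj, ← Complex.exp_neg, map_mul, Complex.conj_ofReal, Complex.conj_I,
    mul_neg]

theorem qHalf_mul_self (φ : ℝ) : qHalf φ * qHalf φ = q φ := by
  rw [qHalf, q, ← Complex.exp_add]; congr 1; push_cast; ring

theorem conj_qHalf_mul (φ : ℝ) : conj (qHalf φ) * q φ = qHalf φ := by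
  have h : qHalf φ ≠ 0 := Complex.exp_ne_zero _
  rw [conj_qHalf, ← qHalf_mul_self, ← mul_assoc, inv_mul_cancel₀ h, one_mul]

/-- The four generators. -/
inductive Gen
  | a | b | c | d

/-- The free unital complex algebra on the four generators. -/
abbrev Free := FreeAlgebra ℂ Gen

/-- A generator as an element of the free algebra. -/
abbrev gen (g : Gen) : Free := FreeAlgebra.ι ℂ g

/-- The defining relations. -/
inductive Rel (φ : ℝ) : Free → Free → Prop
  | ab : Rel φ (gen .a * gen .b) (q φ • (gen .b * gen .a))
  | ac : Rel φ (gen .a * gen .c) (q φ • (gen .c * gen .a))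
  | bc : Rel φ (gen .b * gen .c) (gen .c * gen .b)
  | bd : Rel φ (gen .b * gen .d) (q φ • (gen .d * gen .b))
  | cd : Rel φ (gen .c * gen .d) (q φ • (gen .d * gen .c))
  | da : Rel φ (gen .d * gen .a - (q φ)⁻¹ • (gen .b * gen .c)) 1
  | ad : Rel φ (gen .a * gen .d - q φ • (gen .b * gen .c)) 1

/-- The function algebra of `SL_q(2,ℝ)`, `q = e^{iφ}`. -/
def SLq (φ : ℝ) : Type := RingQuot (Rel φ)

namespace SLq

variable {φ : ℝ}

instance : Ring (SLq φ) := inferInstanceAs (Ring (RingQuot (Rel φ)))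
instance : Algebra ℂ (SLq φ) := inferInstanceAs (Algebra ℂ (RingQuot (Rel φ)))

/-- The quotient map from the free algebra. -/
def mk (φ : ℝ) : Free →ₐ[ℂ] SLq φ := RingQuot.mkAlgHom ℂ (Rel φ)

theorem mk_surjective : Function.Surjective (mk φ) := RingQuot.mkAlgHom_surjective ℂ (Rel φ)

theorem mk_rel {x y : Free} (h : Rel φ x y) : mk φ x = mk φ y := RingQuot.mkAlgHom_rel ℂ h

/-- The generator `a`. -/
def a (φ : ℝ) : SLq φ := mk φ (gen .a)
/-- The generator `b`. -/
def b (φ : ℝ) : SLq φ := mk φ (gen .b)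
/-- The generator `c`. -/
def c (φ : ℝ) : SLq φ := mk φ (gen .c)
/-- The generator `d`. -/
def d (φ : ℝ) : SLq φ := mk φ (gen .d)

theorem a_mul_b : a φ * b φ = q φ • (b φ * a φ) := by
  simpa [a, b, c, d] using mk_rel (φ := φ) .ab
theorem a_mul_c : a φ * c φ = q φ • (c φ * a φ) := by
  simpa [a, b, c, d] using mk_rel (φ := φ) .ac
theorem b_mul_c : b φ * c φ = c φ * b φ := by
  simpa [a, b, c, d] using mk_rel (φ := φ) .bc
theorem b_mul_d : b φ * d φ = q φ • (d φ * b φ) := by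
  simpa [a, b, c, d] using mk_rel (φ := φ) .bd
theorem c_mul_d : c φ * d φ = q φ • (d φ * c φ) := by
  simpa [a, b, c, d] using mk_rel (φ := φ) .cd
theorem d_mul_a : d φ * a φ = 1 + (q φ)⁻¹ • (b φ * c φ) := by
  rw [← sub_eq_iff_eq_add]; simpa [a, b, c, d] using mk_rel (φ := φ) .da
theorem a_mul_d : a φ * d φ = 1 + q φ • (b φ * c φ) := by
  rw [← sub_eq_iff_eq_add]; simpa [a, b, c, d] using mk_rel (φ := φ) .ad

/-- A quadruple of elements of a complex algebra satisfying the defining relations. -/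
structure Quad (φ : ℝ) {B : Type*} [Ring B] [Algebra ℂ B] (a b c d : B) : Prop where
  ab : a * b = q φ • (b * a)
  ac : a * c = q φ • (c * a)
  bc : b * c = c * b
  bd : b * d = q φ • (d * b)
  cd : c * d = q φ • (d * c)
  da : d * a = 1 + (q φ)⁻¹ • (b * c)
  ad : a * d = 1 + q φ • (b * c)

/-- The assignment of values to the generators. -/
def val {B : Type*} (a b c d : B) : Gen → B
  | .a => a
  | .b => b
  | .c => c
  | .d => d

/-- The universal property of `SL_q(2,ℝ)`. -/
def lift {B : Type*} [Ring B] [Algebra ℂ B] {a b c d : B} (h : Quad φ a b c d) :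
    SLq φ →ₐ[ℂ] B :=
  RingQuot.liftAlgHom ℂ ⟨FreeAlgebra.lift ℂ (val a b c d), by
    rintro _ _ (_ | _ | _ | _ | _ | _ | _)
    · simpa [val] using h.ab
    · simpa [val] using h.ac
    · simpa [val] using h.bc
    · simpa [val] using h.bd
    · simpa [val] using h.cd
    · simpa [val, sub_eq_iff_eq_add] using h.da
    · simpa [val, sub_eq_iff_eq_add] using h.ad⟩

section lift

variable {B : Type*} [Ring B] [Algebra ℂ B] {a' b' c' d' : B} (h : Quad φ a' b' c' d')

theorem lift_mk (x : Free) :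
    lift h (mk φ x) = FreeAlgebra.lift ℂ (val a' b' c' d') x :=
  RingQuot.liftAlgHom_mkAlgHom_apply _ _ _ _

@[simp] theorem lift_a : lift h (a φ) = a' := by rw [a, lift_mk]; simp [val]
@[simp] theorem lift_b : lift h (b φ) = b' := by rw [b, lift_mk]; simp [val]
@[simp] theorem lift_c : lift h (c φ) = c' := by rw [c, lift_mk]; simp [val]
@[simp] theorem lift_d : lift h (d φ) = d' := by rw [d, lift_mk]; simp [val]

end lift

@[elab_as_elim]
theorem induction {P : SLq φ → Prop} (halg : ∀ z : ℂ, P (algebraMap ℂ _ z))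
    (ha : P (a φ)) (hb : P (b φ)) (hc : P (c φ)) (hd : P (d φ))
    (hadd : ∀ x y, P x → P y → P (x + y)) (hmul : ∀ x y, P x → P y → P (x * y))
    (x : SLq φ) : P x := by
  obtain ⟨x, rfl⟩ := mk_surjective x
  induction x using FreeAlgebra.induction with
  | grade0 z => simpa using halg z
  | grade1 g => cases g <;> assumption
  | mul x y hx hy => rw [map_mul]; exact hmul _ _ hx hy
  | add x y hx hy => rw [map_add]; exact hadd _ _ hx hy

theorem algHom_ext {B : Type*} [Ring B] [Algebra ℂ B] {f g : SLq φ →ₐ[ℂ] B}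
    (ha : f (a φ) = g (a φ)) (hb : f (b φ) = g (b φ)) (hc : f (c φ) = g (c φ))
    (hd : f (d φ) = g (d φ)) : f = g := by
  ext x
  induction x using induction with
  | halg z => simp
  | ha => exact ha
  | hb => exact hb
  | hc => exact hc
  | hd => exact hd
  | hadd x y hx hy => rw [map_add, map_add, hx, hy]
  | hmul x y hx hy => rw [map_mul, map_mul, hx, hy]

theorem quad (φ : ℝ) : Quad φ (a φ) (b φ) (c φ) (d φ) :=
  ⟨a_mul_b, a_mul_c, b_mul_c, b_mul_d, c_mul_d, d_mul_a, a_mul_d⟩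

theorem comul_quad (φ : ℝ) : Quad φ
    (a φ ⊗ₜ[ℂ] a φ + b φ ⊗ₜ[ℂ] c φ) (a φ ⊗ₜ[ℂ] b φ + b φ ⊗ₜ[ℂ] d φ)
    (c φ ⊗ₜ[ℂ] a φ + d φ ⊗ₜ[ℂ] c φ) (c φ ⊗ₜ[ℂ] b φ + d φ ⊗ₜ[ℂ] d φ) := by
  have hq := q_ne_zero φ
  constructor <;>
  simp only [mul_add, add_mul, Algebra.TensorProduct.tmul_mul_tmul, a_mul_b, a_mul_c, b_mul_d,
    c_mul_d, d_mul_a, a_mul_d, b_mul_c, TensorProduct.tmul_smul, ← TensorProduct.smul_tmul',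
    TensorProduct.tmul_add, TensorProduct.add_tmul, Algebra.TensorProduct.one_def] <;>
  match_scalars <;> field_simp

theorem counit_quad (φ : ℝ) : Quad φ (1 : ℂ) 0 0 1 := by
  constructor <;> simp

theorem antipode_quad (φ : ℝ) : Quad φ (MulOpposite.op (d φ)) (MulOpposite.op (-(q φ)⁻¹ • b φ))
    (MulOpposite.op (-q φ • c φ)) (MulOpposite.op (a φ)) := by
  have hq := q_ne_zero φ
  constructor <;> apply MulOpposite.unop_injective <;>
  simp only [MulOpposite.unop_mul, MulOpposite.unop_op, MulOpposite.unop_smul,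
    MulOpposite.unop_add, MulOpposite.unop_one, smul_mul_assoc, mul_smul_comm, a_mul_b, a_mul_c,
    b_mul_d, c_mul_d, d_mul_a, a_mul_d, b_mul_c] <;>
  match_scalars <;> field_simp

/-- The bialgebra structure: `Δ` and `ε` are the algebra homomorphisms given on the matrix of
generators by matrix comultiplication and by the identity matrix. -/
instance : Bialgebra ℂ (SLq φ) :=
  Bialgebra.ofAlgHom (lift (comul_quad φ)) (lift (counit_quad φ))
    (by
      apply algHom_ext <;>
      simp [TensorProduct.add_tmul, TensorProduct.tmul_add] <;> abel)
    (by apply algHom_ext <;> simp)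
    (by apply algHom_ext <;> simp)

theorem comul_a : Coalgebra.comul (R := ℂ) (a φ) = a φ ⊗ₜ[ℂ] a φ + b φ ⊗ₜ[ℂ] c φ :=
  lift_a (comul_quad φ)
theorem comul_b : Coalgebra.comul (R := ℂ) (b φ) = a φ ⊗ₜ[ℂ] b φ + b φ ⊗ₜ[ℂ] d φ :=
  lift_b (comul_quad φ)
theorem comul_c : Coalgebra.comul (R := ℂ) (c φ) = c φ ⊗ₜ[ℂ] a φ + d φ ⊗ₜ[ℂ] c φ :=
  lift_c (comul_quad φ)
theorem comul_d : Coalgebra.comul (R := ℂ) (d φ) = c φ ⊗ₜ[ℂ] b φ + d φ ⊗ₜ[ℂ] d φ :=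
  lift_d (comul_quad φ)
theorem counit_a : Coalgebra.counit (R := ℂ) (a φ) = 1 := lift_a (counit_quad φ)
theorem counit_b : Coalgebra.counit (R := ℂ) (b φ) = 0 := lift_b (counit_quad φ)
theorem counit_c : Coalgebra.counit (R := ℂ) (c φ) = 0 := lift_c (counit_quad φ)
theorem counit_d : Coalgebra.counit (R := ℂ) (d φ) = 1 := lift_d (counit_quad φ)

/-- The antipode: the algebra antihomomorphism with
`a ↦ d`, `b ↦ -q⁻¹ b`, `c ↦ -q c`, `d ↦ a`. -/
def S (φ : ℝ) : SLq φ →ₗ[ℂ] SLq φ :=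
  (MulOpposite.opLinearEquiv ℂ).symm.toLinearMap ∘ₗ (lift (antipode_quad φ)).toLinearMap

theorem S_apply (x : SLq φ) : S φ x = (lift (antipode_quad φ) x).unop := rfl
theorem S_mul (x y : SLq φ) : S φ (x * y) = S φ y * S φ x := by simp [S_apply]
theorem S_algebraMap (z : ℂ) : S φ (algebraMap ℂ _ z) = algebraMap ℂ _ z := by simp [S_apply]
theorem S_one : S φ 1 = 1 := by simp [S_apply]
theorem S_a : S φ (a φ) = d φ := by simp [S_apply]
theorem S_b : S φ (b φ) = -(q φ)⁻¹ • b φ := by simp [S_apply]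
theorem S_c : S φ (c φ) = -q φ • c φ := by simp [S_apply]
theorem S_d : S φ (d φ) = a φ := by simp [S_apply]

theorem conv_left_mul (u : SLq φ ⊗[ℂ] SLq φ) (z : ℂ)
    (hu : LinearMap.mul' ℂ _ ((S φ).rTensor _ u) = algebraMap ℂ _ z) (v : SLq φ ⊗[ℂ] SLq φ) :
    LinearMap.mul' ℂ _ ((S φ).rTensor _ (u * v)) =
      z • LinearMap.mul' ℂ _ ((S φ).rTensor _ v) := by
  induction v with
  | zero => simp
  | add v w hv hw => rw [mul_add, map_add, map_add, hv, hw, map_add, map_add, smul_add]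
  | tmul y₁ y₂ =>
    have key : LinearMap.mul' ℂ _ ((S φ).rTensor _ (u * (y₁ ⊗ₜ[ℂ] y₂))) =
        S φ y₁ * LinearMap.mul' ℂ _ ((S φ).rTensor _ u) * y₂ := by
      clear hu
      induction u with
      | zero => simp
      | add u w hu hw => rw [add_mul, map_add, map_add, hu, hw, map_add, map_add, mul_add, add_mul]
      | tmul x₁ x₂ => simp [S_mul, mul_assoc]
    rw [key, hu]
    simp [Algebra.algebraMap_eq_smul_one]

theorem conv_right_mul (v : SLq φ ⊗[ℂ] SLq φ) (z : ℂ)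
    (hv : LinearMap.mul' ℂ _ ((S φ).lTensor _ v) = algebraMap ℂ _ z) (u : SLq φ ⊗[ℂ] SLq φ) :
    LinearMap.mul' ℂ _ ((S φ).lTensor _ (u * v)) =
      z • LinearMap.mul' ℂ _ ((S φ).lTensor _ u) := by
  induction u with
  | zero => simp
  | add u w hu hw => rw [add_mul, map_add, map_add, hu, hw, map_add, map_add, smul_add]
  | tmul x₁ x₂ =>
    have key : LinearMap.mul' ℂ _ ((S φ).lTensor _ ((x₁ ⊗ₜ[ℂ] x₂) * v)) =
        x₁ * LinearMap.mul' ℂ _ ((S φ).lTensor _ v) * S φ x₂ := by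
      clear hv
      induction v with
      | zero => simp
      | add u w hu hw => rw [mul_add, map_add, map_add, hu, hw, map_add, map_add, mul_add, add_mul]
      | tmul x₁ x₂ => simp [S_mul, mul_assoc]
    rw [key, hv]
    simp [Algebra.algebraMap_eq_smul_one]

/-- The Hopf algebra structure. -/
instance : HopfAlgebra ℂ (SLq φ) where
  antipode := S φ
  mul_antipode_rTensor_comul := by
    have hq := q_ne_zero φ
    ext x
    simp only [LinearMap.comp_apply, Algebra.linearMap_apply]
    induction x using induction with
    | halg z => simp [Algebra.TensorProduct.algebraMap_apply, S_algebraMap]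
    | ha =>
      simp [comul_a, counit_a, S_a, S_b, d_mul_a]
    | hb =>
      simp [comul_b, counit_b, S_a, S_b, b_mul_d, smul_smul, hq]
    | hc =>
      simp [comul_c, counit_c, S_c, S_d, a_mul_c]
    | hd =>
      simp [comul_d, counit_d, S_c, S_d, a_mul_d, b_mul_c]
    | hadd x y hx hy => simp only [map_add, hx, hy]
    | hmul x y hx hy =>
      rw [Bialgebra.comul_mul, conv_left_mul _ _ hx, hy, Bialgebra.counit_mul, map_mul,
        Algebra.smul_def]
  mul_antipode_lTensor_comul := by
    have hq := q_ne_zero φ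
    ext x
    simp only [LinearMap.comp_apply, Algebra.linearMap_apply]
    induction x using induction with
    | halg z => simp [Algebra.TensorProduct.algebraMap_apply, S_one]
    | ha =>
      simp [comul_a, counit_a, S_a, S_c, a_mul_d]
    | hb =>
      simp [comul_b, counit_b, S_d, S_b, a_mul_b, smul_smul, hq]
    | hc =>
      simp [comul_c, counit_c, S_c, S_a, c_mul_d]
    | hd =>
      simp [comul_d, counit_d, S_b, S_d, d_mul_a, b_mul_c]
    | hadd x y hx hy => simp only [map_add, hx, hy]
    | hmul x y hx hy =>
      rw [Bialgebra.comul_mul, conv_right_mul _ _ hy, hx, Bialgebra.counit_mul, map_mul,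
        Algebra.smul_def, Algebra.commutes]

theorem antipode_eq (x : SLq φ) : HopfAlgebra.antipode ℂ x = S φ x := rfl

/-- The opposite algebra of `SL_q(2,ℝ)` with the complex conjugate scalar multiplication. -/
def ConjOp (φ : ℝ) : Type := (SLq φ)ᵐᵒᵖ

instance : Ring (ConjOp φ) := inferInstanceAs (Ring (SLq φ)ᵐᵒᵖ)

instance : Algebra ℂ (ConjOp φ) :=
  RingHom.toAlgebra' ((algebraMap ℂ (SLq φ)ᵐᵒᵖ).comp (starRingEnd ℂ))
    fun z x => Algebra.commutes (A := (SLq φ)ᵐᵒᵖ) (conj z) x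

/-- Passing to the opposite algebra. -/
def conjOp (x : SLq φ) : ConjOp φ := MulOpposite.op x

theorem smul_conjOp (z : ℂ) (x : SLq φ) : z • conjOp x = conjOp (conj z • x) := by
  rw [Algebra.smul_def, Algebra.smul_def, Algebra.commutes]; rfl

theorem conjOp_mul (x y : SLq φ) : conjOp x * conjOp y = conjOp (y * x) := rfl

theorem star_quad (φ : ℝ) :
    Quad φ (conjOp (a φ)) (conjOp (b φ)) (conjOp (c φ)) (conjOp (d φ)) := by
  have hq := q_ne_zero φ
  constructor
  · rw [conjOp_mul, conjOp_mul, smul_conjOp, a_mul_b, conj_q, smul_smul, inv_mul_cancel₀ hq,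
      one_smul]
  · rw [conjOp_mul, conjOp_mul, smul_conjOp, a_mul_c, conj_q, smul_smul, inv_mul_cancel₀ hq,
      one_smul]
  · rw [conjOp_mul, conjOp_mul, b_mul_c]
  · rw [conjOp_mul, conjOp_mul, smul_conjOp, b_mul_d, conj_q, smul_smul, inv_mul_cancel₀ hq,
      one_smul]
  · rw [conjOp_mul, conjOp_mul, smul_conjOp, c_mul_d, conj_q, smul_smul, inv_mul_cancel₀ hq,
      one_smul]
  · rw [conjOp_mul, conjOp_mul, smul_conjOp, a_mul_d, conj_q_inv, ← b_mul_c]; rfl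
  · rw [conjOp_mul, conjOp_mul, smul_conjOp, d_mul_a, conj_q, ← b_mul_c]; rfl

/-- The involution: the antilinear antihomomorphism fixing the four generators. -/
instance : Star (SLq φ) where
  star x := MulOpposite.unop (α := SLq φ) (lift (star_quad φ) x)

theorem star_def (x : SLq φ) : star x = MulOpposite.unop (α := SLq φ) (lift (star_quad φ) x) := rfl
theorem star_a : star (a φ) = a φ := by rw [star_def, lift_a]; rfl
theorem star_b : star (b φ) = b φ := by rw [star_def, lift_b]; rfl
theorem star_c : star (c φ) = c φ := by rw [star_def, lift_c]; rfl
theorem star_d : star (d φ) = d φ := by rw [star_def, lift_d]; rfl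
theorem star_mul' (x y : SLq φ) : star (x * y) = star y * star x := by
  rw [star_def, map_mul]; rfl
theorem star_add' (x y : SLq φ) : star (x + y) = star x + star y := by
  rw [star_def, map_add]; rfl
theorem star_algebraMap (z : ℂ) : star (algebraMap ℂ (SLq φ) z) = algebraMap ℂ _ (conj z) := by
  rw [star_def, AlgHom.commutes]; rfl

instance : StarRing (SLq φ) where
  star_involutive x := by
    induction x using induction with
    | halg z => simp [star_algebraMap]
    | ha => simp [star_a]
    | hb => simp [star_b]
    | hc => simp [star_c]
    | hd => simp [star_d]
    | hadd x y hx hy => rw [star_add', star_add', hx, hy]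
    | hmul x y hx hy => rw [star_mul', star_mul', hx, hy]
  star_mul := star_mul'
  star_add := star_add'

instance : StarModule ℂ (SLq φ) where
  star_smul z x := by
    rw [Algebra.smul_def, star_mul', star_algebraMap, Algebra.smul_def, Algebra.commutes]; rfl

/-- The antilinear map `τ = * ∘ S`. -/
def τ (φ : ℝ) : SLq φ →ₛₗ[starRingEnd ℂ] SLq φ where
  toFun x := star (HopfAlgebra.antipode ℂ x)
  map_add' x y := by rw [map_add, star_add]
  map_smul' z x := by rw [map_smul, star_smul]; rfl

theorem τ_apply (x : SLq φ) : τ φ x = star (HopfAlgebra.antipode ℂ x) := rfl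

theorem τ_mul (x y : SLq φ) : τ φ (x * y) = τ φ x * τ φ y := by
  rw [τ_apply, antipode_eq, S_mul, star_mul]; rfl

theorem τ_a : τ φ (a φ) = d φ := by rw [τ_apply, antipode_eq, S_a, star_d]
theorem τ_d : τ φ (d φ) = a φ := by rw [τ_apply, antipode_eq, S_d, star_a]
theorem τ_b : τ φ (b φ) = -q φ • b φ := by
  rw [τ_apply, antipode_eq, S_b, star_smul, star_b, star_neg, ← starRingEnd_apply, conj_q_inv]
theorem τ_c : τ φ (c φ) = -(q φ)⁻¹ • c φ := by
  rw [τ_apply, antipode_eq, S_c, star_smul, star_c, star_neg, ← starRingEnd_apply, conj_q]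

end SLq

open SLq

variable (φ μ ν : ℝ)

/-- The element `a - d + 2 q^{1/2} μ b`. -/
def coidealGen₁ : SLq φ := a φ - d φ + (2 * qHalf φ * μ) • b φ

/-- The element `q ν b + c`. -/
def coidealGen₂ : SLq φ := (q φ * ν) • b φ + c φ

/-- The subspace `C_{μν}` spanned by `a - d + 2 q^{1/2} μ b` and `q ν b + c`. -/
def C : Submodule ℂ (SLq φ) := Submodule.span ℂ {coidealGen₁ φ μ, coidealGen₂ φ ν}

/-- The right ideal `R_{μν} = C_{μν} · SL_q(2,ℝ)`; right modules are modules over the opposite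
algebra. -/
def R : Submodule (SLq φ)ᵐᵒᵖ (SLq φ) := Submodule.span (SLq φ)ᵐᵒᵖ (C φ μ ν : Set (SLq φ))

/-- The right ideal `R_{μν}` as a complex subspace. -/
abbrev Rℂ : Submodule ℂ (SLq φ) := (R φ μ ν).restrictScalars ℂ

variable {φ μ ν}

theorem mem_R_mul {x : SLq φ} (hx : x ∈ R φ μ ν) (y : SLq φ) : x * y ∈ R φ μ ν :=
  (R φ μ ν).smul_mem (MulOpposite.op y) hx

theorem gen₁_mem : coidealGen₁ φ μ ∈ R φ μ ν :=
  Submodule.subset_span (Submodule.subset_span (by simp))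

theorem gen₂_mem : coidealGen₂ φ ν ∈ R φ μ ν :=
  Submodule.subset_span (Submodule.subset_span (by simp))

/-- To check a property on `R_{μν}` it suffices to check it on `x · y`, `x` one of the two
generators. -/
theorem R_induction {P : SLq φ → Prop} (h0 : P 0) (hadd : ∀ x y, P x → P y → P (x + y))
    (h₁ : ∀ y, P (coidealGen₁ φ μ * y)) (h₂ : ∀ y, P (coidealGen₂ φ ν * y))
    {x : SLq φ} (hx : x ∈ R φ μ ν) : P x := by
  have hC : ∀ x ∈ C φ μ ν, ∀ y, P (x * y) := by
    intro x hx
    induction hx using Submodule.span_induction with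
    | mem x hx =>
      rcases hx with rfl | rfl
      · exact h₁
      · exact h₂
    | zero => intro y; simpa using h0
    | add x x' _ _ hx hx' => intro y; rw [add_mul]; exact hadd _ _ (hx y) (hx' y)
    | smul z x _ hx => intro y; rw [smul_mul_assoc, ← mul_smul_comm]; exact hx _
  have : ∀ y, P (x * y) := by
    induction hx using Submodule.span_induction with
    | mem x hx => exact hC x hx
    | zero => intro y; simpa using h0
    | add x x' _ _ hx hx' => intro y; rw [add_mul]; exact hadd _ _ (hx y) (hx' y)
    | smul z x _ hx =>
      intro y
      rw [MulOpposite.smul_eq_mul_unop, mul_assoc]; exact hx _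
  simpa using this 1

theorem map_mkQ_mul {u : SLq φ ⊗[ℂ] SLq φ}
    (hu : TensorProduct.map (Rℂ φ μ ν).mkQ (Rℂ φ μ ν).mkQ u = 0) (v : SLq φ ⊗[ℂ] SLq φ) :
    TensorProduct.map (Rℂ φ μ ν).mkQ (Rℂ φ μ ν).mkQ (u * v) = 0 := by
  induction v with
  | zero => simp
  | add v w hv hw => rw [mul_add, map_add, hv, hw, add_zero]
  | tmul y₁ y₂ =>
    have key : ∀ u : SLq φ ⊗[ℂ] SLq φ,
        TensorProduct.map (Rℂ φ μ ν).mkQ (Rℂ φ μ ν).mkQ (u * y₁ ⊗ₜ[ℂ] y₂) =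
        TensorProduct.map
          ((Rℂ φ μ ν).mapQ (Rℂ φ μ ν) (LinearMap.mulRight ℂ y₁) fun x hx => mem_R_mul hx y₁)
          ((Rℂ φ μ ν).mapQ (Rℂ φ μ ν) (LinearMap.mulRight ℂ y₂) fun x hx => mem_R_mul hx y₂)
          (TensorProduct.map (Rℂ φ μ ν).mkQ (Rℂ φ μ ν).mkQ u) := by
      intro u
      induction u with
      | zero => simp
      | add u w hu hw => rw [add_mul, map_add, hu, hw, map_add, map_add]
      | tmul x₁ x₂ =>
        rw [Algebra.TensorProduct.tmul_mul_tmul]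
        simp only [TensorProduct.map_tmul]
        rfl
    rw [key, hu, map_zero]

theorem comul_gen₁ : Coalgebra.comul (R := ℂ) (coidealGen₁ φ μ) =
    coidealGen₁ φ μ ⊗ₜ[ℂ] (a φ + (2 * qHalf φ * μ) • b φ) +
    (d φ - (2 * qHalf φ * μ) • b φ) ⊗ₜ[ℂ] coidealGen₁ φ μ +
    b φ ⊗ₜ[ℂ] coidealGen₂ φ ν - coidealGen₂ φ ν ⊗ₜ[ℂ] b φ := by
  simp only [coidealGen₁, coidealGen₂, map_add, map_sub, map_smul, comul_a, comul_b, comul_d,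
    TensorProduct.tmul_add, TensorProduct.add_tmul, TensorProduct.tmul_sub, TensorProduct.sub_tmul,
    TensorProduct.tmul_smul, ← TensorProduct.smul_tmul']
  module

theorem comul_gen₂ : Coalgebra.comul (R := ℂ) (coidealGen₂ φ ν) =
    (a φ + (2 * qHalf φ * μ) • b φ) ⊗ₜ[ℂ] coidealGen₂ φ ν +
    coidealGen₂ φ ν ⊗ₜ[ℂ] (d φ - (2 * qHalf φ * μ) • b φ) -
    coidealGen₁ φ μ ⊗ₜ[ℂ] c φ + c φ ⊗ₜ[ℂ] coidealGen₁ φ μ := by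
  simp only [coidealGen₁, coidealGen₂, map_add, map_smul, comul_c, comul_b,
    TensorProduct.tmul_add, TensorProduct.add_tmul, TensorProduct.tmul_sub, TensorProduct.sub_tmul,
    TensorProduct.tmul_smul, ← TensorProduct.smul_tmul']
  module

theorem counit_gen₁ : Coalgebra.counit (R := ℂ) (coidealGen₁ φ μ) = 0 := by
  simp [coidealGen₁, counit_a, counit_b, counit_d]

theorem counit_gen₂ : Coalgebra.counit (R := ℂ) (coidealGen₂ φ ν) = 0 := by
  simp [coidealGen₂, counit_b, counit_c]

theorem mkQ_gen₁ : (Rℂ φ μ ν).mkQ (coidealGen₁ φ μ) = 0 := by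
  simpa using gen₁_mem

theorem mkQ_gen₂ : (Rℂ φ μ ν).mkQ (coidealGen₂ φ ν) = 0 := by
  simpa using gen₂_mem

/-- `R_{μν}` is a two-sided coideal. -/
instance : (Rℂ φ μ ν).IsCoideal where
  counit_eq_zero x hx := by
    refine R_induction (μ := μ) (ν := ν) (P := fun x => Coalgebra.counit (R := ℂ) x = 0)
      ?_ ?_ ?_ ?_ hx
    · simp
    · intro x y hx hy; rw [map_add, hx, hy, add_zero]
    · intro y; rw [Bialgebra.counit_mul, counit_gen₁, zero_mul]
    · intro y; rw [Bialgebra.counit_mul, counit_gen₂, zero_mul]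
  map_mkQ_comul_eq_zero x hx := by
    refine R_induction (μ := μ) (ν := ν) (P := fun x =>
      TensorProduct.map (Rℂ φ μ ν).mkQ (Rℂ φ μ ν).mkQ (Coalgebra.comul x) = 0) ?_ ?_ ?_ ?_ hx
    · simp
    · intro x y hx hy; rw [map_add, map_add, hx, hy, add_zero]
    · intro y
      rw [Bialgebra.comul_mul]
      refine map_mkQ_mul ?_ _
      rw [comul_gen₁ (ν := ν)]
      simp only [map_add, map_sub, TensorProduct.map_tmul, mkQ_gen₁, mkQ_gen₂,
        TensorProduct.zero_tmul, TensorProduct.tmul_zero, add_zero, sub_zero]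
    · intro y
      rw [Bialgebra.comul_mul]
      refine map_mkQ_mul ?_ _
      rw [comul_gen₂ (μ := μ)]
      simp only [map_add, map_sub, TensorProduct.map_tmul, mkQ_gen₁, mkQ_gen₂,
        TensorProduct.zero_tmul, TensorProduct.tmul_zero, add_zero, sub_zero]

theorem τ_gen₁ : τ φ (coidealGen₁ φ μ) = -coidealGen₁ φ μ := by
  have h := conj_qHalf_mul φ
  simp only [coidealGen₁, map_add, map_sub, LinearMap.map_smulₛₗ, τ_a, τ_b, τ_d, map_mul,
    Complex.conj_ofReal, map_ofNat, smul_smul]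
  rw [show 2 * conj (qHalf φ) * (μ : ℂ) * -q φ = -(2 * (conj (qHalf φ) * q φ) * μ) by ring, h]
  module

theorem τ_gen₂ : τ φ (coidealGen₂ φ ν) = -(q φ)⁻¹ • coidealGen₂ φ ν := by
  have hq := q_ne_zero φ
  simp only [coidealGen₂, map_add, LinearMap.map_smulₛₗ, τ_b, τ_c, map_mul, Complex.conj_ofReal,
    conj_q, smul_smul]
  match_scalars <;> field_simp

theorem τ_mem_R {x : SLq φ} (hx : x ∈ R φ μ ν) : τ φ x ∈ R φ μ ν := by
  refine R_induction (μ := μ) (ν := ν) (P := fun x => τ φ x ∈ R φ μ ν) ?_ ?_ ?_ ?_ hx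
  · simp
  · intro x y hx hy; rw [map_add]; exact add_mem hx hy
  · intro y
    rw [τ_mul, τ_gen₁]
    exact mem_R_mul (neg_mem gen₁_mem) _
  · intro y
    rw [τ_mul, τ_gen₂, smul_mul_assoc]
    exact (Rℂ φ μ ν).smul_mem _ (mem_R_mul gen₂_mem _)

variable (φ μ ν)

/-- The coisotropic subgroup `K_{μν} = SL_q(2,ℝ) / R_{μν}`. -/
def K : Type := SLq φ ⧸ Rℂ φ μ ν

instance : AddCommGroup (K φ μ ν) := inferInstanceAs (AddCommGroup (SLq φ ⧸ Rℂ φ μ ν))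

instance : Module ℂ (K φ μ ν) := inferInstanceAs (Module ℂ (SLq φ ⧸ Rℂ φ μ ν))

/-- The coalgebra structure induced from `SL_q(2,ℝ)`. -/
instance : Coalgebra ℂ (K φ μ ν) := inferInstanceAs (Coalgebra ℂ (SLq φ ⧸ Rℂ φ μ ν))

/-- The right `SL_q(2,ℝ)`-module structure induced by multiplication. -/
instance : Module (SLq φ)ᵐᵒᵖ (K φ μ ν) := inferInstanceAs (Module (SLq φ)ᵐᵒᵖ (SLq φ ⧸ R φ μ ν))

/-- The quotient map `r_{μν}`. -/
def r : SLq φ →ₗ[ℂ] K φ μ ν := (Rℂ φ μ ν).mkQ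

/-- The antilinear map `τ_K` on `K_{μν}` with `τ_K ∘ r_{μν} = r_{μν} ∘ τ`. -/
def τK : K φ μ ν →ₛₗ[starRingEnd ℂ] K φ μ ν :=
  (Rℂ φ μ ν).mapQ (Rℂ φ μ ν) (τ φ) fun _ hx => τ_mem_R hx

theorem r_surjective : Function.Surjective (r φ μ ν) := (Rℂ φ μ ν).mkQ_surjective

theorem comul_r (x : SLq φ) : Coalgebra.comul (R := ℂ) (r φ μ ν x) =
    TensorProduct.map (r φ μ ν) (r φ μ ν) (Coalgebra.comul x) :=
  Coalgebra.Quotient.comul_mk (Rℂ φ μ ν) x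

theorem counit_r (x : SLq φ) : Coalgebra.counit (R := ℂ) (r φ μ ν x) = Coalgebra.counit x :=
  Coalgebra.Quotient.counit_mk (Rℂ φ μ ν) x

theorem op_smul_r (x y : SLq φ) : MulOpposite.op y • r φ μ ν x = r φ μ ν (x * y) := rfl

theorem τK_r (x : SLq φ) : τK φ μ ν (r φ μ ν x) = r φ μ ν (τ φ x) := rfl

variable {φ μ ν}

/-- The involution of the coordinate Hopf algebra `ℂ[λ,λ⁻¹]` of `ℝ_+`: antilinear, `λ* = λ`. -/
def starRPlus (f : ℂ[T;T⁻¹]) : ℂ[T;T⁻¹] := AddMonoidAlgebra.mapRingHom ℤ (starRingEnd ℂ) f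

/-- The involution of the coordinate Hopf algebra `ℂ[z,z⁻¹]` of `S¹`: antilinear, `z* = z⁻¹`. -/
def starS1 (f : ℂ[T;T⁻¹]) : ℂ[T;T⁻¹] :=
  LaurentPolynomial.invert (AddMonoidAlgebra.mapRingHom ℤ (starRingEnd ℂ) f)

/-- `τ = * ∘ S` for `ℝ_+`. -/
def τRPlus (f : ℂ[T;T⁻¹]) : ℂ[T;T⁻¹] := starRPlus (HopfAlgebra.antipode ℂ f)

/-- `τ = * ∘ S` for `S¹`. -/
def τS1 (f : ℂ[T;T⁻¹]) : ℂ[T;T⁻¹] := starS1 (HopfAlgebra.antipode ℂ f)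

/-- Isomorphism of real coalgebras `(A, σ)`, `(B, ρ)`: a complex coalgebra isomorphism that
intertwines the antilinear maps `σ` and `ρ`. -/
def RealCoalgIso {A B : Type*} [AddCommGroup A] [Module ℂ A] [Coalgebra ℂ A] [AddCommGroup B]
    [Module ℂ B] [Coalgebra ℂ B] (σ : A → A) (ρ : B → B) : Prop :=
  ∃ e : A ≃ₗc[ℂ] B, ∀ x, e (σ x) = ρ (e x)

end QuantumSL2

end

/-!
Call a vector `v` of a right `SL_q(2,ℝ)`-module of weight `(s, t)` if it is
annihilated by the generators of `C_{μν}` for `μ = (s + t) / 2`, `ν = s t`; so `K_{μν}` is the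
universal right module generated by such a vector, the class of `1`. The shift `a + q^{1/2} s b`
takes weight `(s, t)` to weight `(q s, q⁻¹ t)`, it is undone by the shift attached to `q⁻¹ t`, and
it takes group-like vectors of `K_{μν}` to group-like vectors. So the class of `1` is part of a
two-sided ladder of group-like vectors, the `n`-th one of weight `(qⁿ s, q⁻ⁿ t)`, and `τ` either
fixes each of them (`t` conjugate to `s`) or reverses the ladder (`s` and `t` real).

Part (ii): the `n`-th vector of the ladder also generates `K_{μν}`, and by universality it
identifies `K_{μν}` with `K_{μₙν}`. Since rescaling `b` and `c` changes `(μ, ν)` to `(uμ, u²ν)`,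
this brings every member of the special series to `(μ, ν) = (1, 1)`.

In the other cases of (i) the two weights `qⁿ s` and `q⁻ⁿ t` at each position differ. Then `a` and
`b` can be recovered from the two shifts, hence the ladder spans `K_{μν}`, and it is linearly
independent because the formulas for `a` and `b` in terms of the shifts define a module with basis
`(eₙ)`, `n ∈ ℤ`. A coalgebra with a basis of group-like elements indexed by `ℤ` is the coalgebra
of Laurent polynomials, and the action of `τ` on the basis decides between `ℝ_+` and `S¹`.
-/

noncomputable section

namespace QuantumSL2

open SLq
open scoped TensorProduct LaurentPolynomial ComplexConjugate RightActions

section RightModule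

variable {φ μ ν : ℝ}

instance : IsScalarTower ℂ (SLq φ)ᵐᵒᵖ (K φ μ ν) where
  smul_assoc z y v := by
    obtain ⟨x, rfl⟩ := r_surjective φ μ ν v
    rw [← MulOpposite.op_unop y, ← MulOpposite.op_smul, op_smul_r, op_smul_r, mul_smul_comm,
      map_smul]

theorem r_eq_op_smul (x : SLq φ) : r φ μ ν x = r φ μ ν 1 <• x := by rw [op_smul_r, one_mul]

variable {M : Type*} [AddCommGroup M] [Module (SLq φ)ᵐᵒᵖ M]

/-- The right module map `x ↦ v x` from the regular module determined by a vector `v`. -/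
def orbit (v : M) : SLq φ →ₗ[(SLq φ)ᵐᵒᵖ] M where
  toFun x := v <• x
  map_add' x y := add_smul (MulOpposite.op x) (MulOpposite.op y) v
  map_smul' y x := mul_smul y (MulOpposite.op x) v

theorem R_eq_span : R φ μ ν = Submodule.span (SLq φ)ᵐᵒᵖ {coidealGen₁ φ μ, coidealGen₂ φ ν} :=
  Submodule.span_span_of_tower ℂ (SLq φ)ᵐᵒᵖ _

theorem R_le_iff {P : Submodule (SLq φ)ᵐᵒᵖ (SLq φ)} :
    R φ μ ν ≤ P ↔ coidealGen₁ φ μ ∈ P ∧ coidealGen₂ φ ν ∈ P := by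
  rw [R_eq_span, Submodule.span_le, Set.pair_subset_iff, SetLike.mem_coe, SetLike.mem_coe]

theorem K.hom_ext {f g : K φ μ ν →ₗ[(SLq φ)ᵐᵒᵖ] M} (h : f (r φ μ ν 1) = g (r φ μ ν 1)) :
    f = g := by
  ext v
  obtain ⟨x, rfl⟩ := r_surjective φ μ ν v
  rw [r_eq_op_smul, map_smul, map_smul, h]

end RightModule

section Coalgebra

variable {φ μ ν μ' ν' : ℝ}

theorem τK_op_smul (v : K φ μ ν) (y : SLq φ) : τK φ μ ν (v <• y) = τK φ μ ν v <• τ φ y := by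
  obtain ⟨x, rfl⟩ := r_surjective φ μ ν v
  rw [op_smul_r, τK_r, τ_mul, τK_r, op_smul_r]

theorem τK_r_one : τK φ μ ν (r φ μ ν 1) = r φ μ ν 1 := by
  rw [τK_r, τ_apply, antipode_eq, S_one, star_one]

theorem isGroupLikeElem_r_one : IsGroupLikeElem ℂ (r φ μ ν 1) where
  counit_eq_one := by rw [counit_r, Bialgebra.counit_one]
  comul_eq_tmul_self := by
    rw [comul_r, Bialgebra.comul_one, Algebra.TensorProduct.one_def, TensorProduct.map_tmul]

theorem counit_op_smul (v : K φ μ ν) (y : SLq φ) :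
    Coalgebra.counit (R := ℂ) (v <• y) = Coalgebra.counit v * Coalgebra.counit (R := ℂ) y := by
  obtain ⟨x, rfl⟩ := r_surjective φ μ ν v
  rw [op_smul_r, counit_r, Bialgebra.counit_mul, counit_r]

theorem map_r_mul_of_map_r_eq_tmul {u : SLq φ ⊗[ℂ] SLq φ} {v v' : K φ μ ν}
    (hu : TensorProduct.map (r φ μ ν) (r φ μ ν) u = v ⊗ₜ v') (w : SLq φ ⊗[ℂ] SLq φ) :
    TensorProduct.map (r φ μ ν) (r φ μ ν) (u * w) =
      TensorProduct.map ((orbit v).restrictScalars ℂ) ((orbit v').restrictScalars ℂ) w := by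
  induction w with
  | zero => simp
  | add w w' hw hw' => rw [mul_add, map_add, map_add, hw, hw']
  | tmul y z =>
    have key (u : SLq φ ⊗[ℂ] SLq φ) : TensorProduct.map (r φ μ ν) (r φ μ ν) (u * y ⊗ₜ z) =
        TensorProduct.map (DistribSMul.toLinearMap ℂ _ (MulOpposite.op y))
          (DistribSMul.toLinearMap ℂ _ (MulOpposite.op z))
          (TensorProduct.map (r φ μ ν) (r φ μ ν) u) := by
      induction u with
      | zero => simp
      | add u u' hu hu' => rw [add_mul, map_add, hu, hu', map_add, map_add]
      | tmul x x' => rw [Algebra.TensorProduct.tmul_mul_tmul]; rfl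
    rw [key, hu]
    rfl

theorem comul_op_smul {v : K φ μ ν} (hv : IsGroupLikeElem ℂ v) (y : SLq φ) :
    Coalgebra.comul (R := ℂ) (v <• y) =
      TensorProduct.map ((orbit v).restrictScalars ℂ) ((orbit v).restrictScalars ℂ)
        (Coalgebra.comul y) := by
  obtain ⟨x, rfl⟩ := r_surjective φ μ ν v
  rw [op_smul_r, comul_r, Bialgebra.comul_mul]
  exact map_r_mul_of_map_r_eq_tmul (by rw [← comul_r, hv.comul_eq_tmul_self]) _

/-- The orbit map of a group-like vector as a homomorphism of coalgebras. -/
def orbitCoalgHom {v : K φ μ ν} (hv : IsGroupLikeElem ℂ v) : SLq φ →ₗc[ℂ] K φ μ ν where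
  __ := (orbit v).restrictScalars ℂ
  counit_comp := LinearMap.ext fun y =>
    (counit_op_smul v y).trans (by rw [hv.counit_eq_one, one_mul])
  map_comp_comul := LinearMap.ext fun y => (comul_op_smul hv y).symm

variable {D : Type*} [AddCommGroup D] [Module ℂ D] [Coalgebra ℂ D]

/-- A linear isomorphism from `K_{μν}` is an isomorphism of coalgebras as soon as it is induced
by a homomorphism of coalgebras on `SL_q(2,ℝ)`. -/
def K.coalgEquiv (e : K φ μ ν ≃ₗ[ℂ] D) (F : SLq φ →ₗc[ℂ] D) (h : ∀ x, e (r φ μ ν x) = F x) :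
    K φ μ ν ≃ₗc[ℂ] D where
  __ := e
  counit_comp := LinearMap.ext fun v => by
    obtain ⟨x, rfl⟩ := r_surjective φ μ ν v
    rw [counit_r, ← CoalgHomClass.counit_comp_apply F, ← h]
    rfl
  map_comp_comul := LinearMap.ext fun v => by
    have hF : e.toLinearMap ∘ₗ r φ μ ν = F := LinearMap.ext h
    obtain ⟨x, rfl⟩ := r_surjective φ μ ν v
    calc TensorProduct.map e.toLinearMap e.toLinearMap (Coalgebra.comul (r φ μ ν x))
      _ = TensorProduct.map (F : SLq φ →ₗ[ℂ] D) F (Coalgebra.comul x) := by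
        rw [comul_r, ← hF, TensorProduct.map_comp]; rfl
      _ = Coalgebra.comul (e (r φ μ ν x)) := by rw [CoalgHomClass.map_comp_comul_apply, h]

end Coalgebra

section Shift

theorem qHalf_ne_zero (φ : ℝ) : qHalf φ ≠ 0 := Complex.exp_ne_zero _

variable {φ : ℝ} {M : Type*} [AddCommGroup M] [Module (SLq φ)ᵐᵒᵖ M] (s t z : ℂ) (v : M)
  (x y : SLq φ)

theorem op_smul_add : v <• (x + y) = v <• x + v <• y := add_smul _ _ _

theorem op_smul_b_c : v <• b φ <• c φ = v <• c φ <• b φ := by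
  rw [op_smul_op_smul, op_smul_op_smul, b_mul_c]

variable [Module ℂ M] [IsScalarTower ℂ (SLq φ)ᵐᵒᵖ M]

theorem op_smul_smul : v <• (z • x) = z • v <• x := smul_assoc z _ v

theorem smul_op_smul : (z • v) <• x = z • v <• x := smul_comm _ _ _

theorem op_smul_a_c : v <• a φ <• c φ = q φ • v <• c φ <• a φ := by
  rw [op_smul_op_smul, op_smul_op_smul, a_mul_c, op_smul_smul]

theorem op_smul_b_a : v <• b φ <• a φ = (q φ)⁻¹ • v <• a φ <• b φ := by
  rw [op_smul_op_smul, op_smul_op_smul, a_mul_b, op_smul_smul, inv_smul_smul₀ (q_ne_zero φ)]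

theorem op_smul_b_d : v <• b φ <• d φ = q φ • v <• d φ <• b φ := by
  rw [op_smul_op_smul, op_smul_op_smul, b_mul_d, op_smul_smul]

theorem op_smul_a_d : v <• a φ <• d φ = v + q φ • v <• c φ <• b φ := by
  rw [op_smul_op_smul, op_smul_op_smul, a_mul_d, op_smul_add, op_smul_smul, MulOpposite.op_one,
    one_smul, b_mul_c]

theorem op_smul_d_a : v <• d φ <• a φ = v + (q φ)⁻¹ • v <• c φ <• b φ := by
  rw [op_smul_op_smul, op_smul_op_smul, d_mul_a, op_smul_add, op_smul_smul, MulOpposite.op_one,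
    one_smul, b_mul_c]

/-- The element `a + q^{1/2} s b`, which raises the weight parameter `s`. -/
def shift (φ : ℝ) (s : ℂ) : SLq φ := a φ + (qHalf φ * s) • b φ

theorem op_smul_shift : v <• shift φ s = v <• a φ + (qHalf φ * s) • v <• b φ := by
  rw [shift, op_smul_add, op_smul_smul]

-- In the proofs below the right action is generalized before calling `module`, which would
-- otherwise take elements of the opposite algebra for scalars.
theorem smul_op_smul_b :
    (qHalf φ * (s - t)) • v <• b φ = v <• shift φ s - v <• shift φ t := by
  rw [op_smul_shift, op_smul_shift]
  generalize v <• a φ = va, v <• b φ = vb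
  module

theorem smul_op_smul_a :
    (s - t) • v <• a φ = s • v <• shift φ t - t • v <• shift φ s := by
  rw [op_smul_shift, op_smul_shift]
  generalize v <• a φ = va, v <• b φ = vb
  module

end Shift

section Weight

variable {φ : ℝ} {M : Type*} [AddCommGroup M] [Module ℂ M] [Module (SLq φ)ᵐᵒᵖ M]

variable (φ) in
/-- A vector of a right module has weight `(s, t)` if it is annihilated by
`a - d + q^{1/2} (s + t) b` and `q s t b + c`; for `s + t = 2 μ` and `s t = ν` these are the
relations that the class of `1` satisfies in `K_{μν}`. -/
structure IsWeight (s t : ℂ) (v : M) : Prop where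
  op_smul_c : v <• c φ = -(q φ * s * t) • v <• b φ
  op_smul_d : v <• d φ = v <• a φ + (qHalf φ * (s + t)) • v <• b φ

namespace IsWeight

variable {s t : ℂ} {v : M} {μ ν : ℝ}

theorem symm (h : IsWeight φ s t v) : IsWeight φ t s v where
  op_smul_c := by rw [h.op_smul_c, mul_right_comm]
  op_smul_d := by rw [h.op_smul_d, add_comm s]

variable [IsScalarTower ℂ (SLq φ)ᵐᵒᵖ M]

theorem iff_op_smul_gen (h₁ : s + t = 2 * μ) (h₂ : s * t = ν) :
    IsWeight φ s t v ↔ v <• coidealGen₁ φ μ = 0 ∧ v <• coidealGen₂ φ ν = 0 := by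
  have e₁ : v <• coidealGen₁ φ μ =
      v <• a φ + (qHalf φ * (s + t)) • v <• b φ - v <• d φ := by
    rw [coidealGen₁, sub_eq_add_neg, ← neg_one_smul ℂ, h₁]
    simp only [op_smul_add, op_smul_smul]
    generalize v <• a φ = va, v <• b φ = vb, v <• d φ = vd
    module
  have e₂ : v <• coidealGen₂ φ ν = v <• c φ - -(q φ * s * t) • v <• b φ := by
    rw [coidealGen₂, op_smul_add, op_smul_smul, mul_assoc, h₂]
    generalize v <• b φ = vb, v <• c φ = vc
    module
  rw [e₁, e₂, sub_eq_zero, sub_eq_zero, eq_comm (b := v <• d φ)]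
  exact ⟨fun h => ⟨h.op_smul_d, h.op_smul_c⟩, fun h => ⟨h.2, h.1⟩⟩

theorem r_one (h₁ : s + t = 2 * μ) (h₂ : s * t = ν) : IsWeight φ s t (r φ μ ν 1) := by
  rw [iff_op_smul_gen h₁ h₂, ← r_eq_op_smul, ← r_eq_op_smul]
  exact ⟨mkQ_gen₁, mkQ_gen₂⟩

/-- The universal property of the right module `K_{μν}`: a vector of weight `(s, t)` with
`s + t = 2 μ` and `s t = ν` is the image of the class of `1` under a right module map. -/
def lift (h : IsWeight φ s t v) (h₁ : s + t = 2 * μ) (h₂ : s * t = ν) :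
    K φ μ ν →ₗ[(SLq φ)ᵐᵒᵖ] M :=
  (R φ μ ν).liftQ (orbit v) (R_le_iff.2 ((iff_op_smul_gen h₁ h₂).1 h))

theorem lift_r_one (h : IsWeight φ s t v) (h₁ : s + t = 2 * μ) (h₂ : s * t = ν) :
    h.lift h₁ h₂ (r φ μ ν 1) = v := one_smul _ v

theorem op_smul_a_a (h : IsWeight φ s t v) : v <• a φ <• a φ =
    v - (s * t) • v <• b φ <• b φ - ((qHalf φ)⁻¹ * (s + t)) • v <• a φ <• b φ := by
  have hq := q_ne_zero φ
  have hp := qHalf_ne_zero φ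
  have key := op_smul_d_a (φ := φ) v
  rw [h.op_smul_d, h.op_smul_c, smul_add, smul_op_smul, smul_op_smul, op_smul_b_a,
    ← eq_sub_iff_add_eq] at key
  rw [key, ← qHalf_mul_self]
  rw [← qHalf_mul_self] at hq
  generalize v <• a φ <• b φ = vab, v <• b φ <• b φ = vbb
  match_scalars <;> field_simp

theorem shift_left (h : IsWeight φ s t v) :
    IsWeight φ (q φ * s) ((q φ)⁻¹ * t) (v <• shift φ s) := by
  have hp := qHalf_ne_zero φ
  constructor
  · simp only [op_smul_shift, smul_add, smul_op_smul, op_smul_a_c, op_smul_b_c, h.op_smul_c,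
      op_smul_b_a, ← qHalf_mul_self]
    generalize v <• a φ <• b φ = vab, v <• b φ <• b φ = vbb
    match_scalars <;> field_simp
  · simp only [op_smul_shift, smul_add, smul_op_smul, op_smul_a_d, op_smul_b_d, h.op_smul_c,
      h.op_smul_d, op_smul_b_a, h.op_smul_a_a, ← qHalf_mul_self]
    generalize v <• a φ <• b φ = vab, v <• b φ <• b φ = vbb
    match_scalars <;> field_simp <;> ring

theorem shift_right (h : IsWeight φ s t v) :
    IsWeight φ ((q φ)⁻¹ * s) (q φ * t) (v <• shift φ t) :=
  h.symm.shift_left.symm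

theorem shift_shift (h : IsWeight φ s t v) :
    v <• shift φ s <• shift φ ((q φ)⁻¹ * t) = v := by
  have hp := qHalf_ne_zero φ
  simp only [op_smul_shift, smul_add, smul_op_smul, op_smul_b_a, h.op_smul_a_a, ← qHalf_mul_self]
  generalize v <• a φ <• b φ = vab, v <• b φ <• b φ = vbb
  match_scalars <;> field_simp <;> ring

theorem op_smul_τ_shift (h : IsWeight φ s t v) (w : ℂ) :
    v <• τ φ (shift φ w) = v <• shift φ (s + t - conj w) := by
  rw [shift, map_add, LinearMap.map_smulₛₗ, τ_a, τ_b, smul_smul, op_smul_add, op_smul_smul,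
    h.op_smul_d, map_mul, mul_neg, mul_right_comm, conj_qHalf_mul, op_smul_shift]
  generalize v <• a φ = va, v <• b φ = vb
  module

theorem isGroupLikeElem_shift {v : K φ μ ν} (h : IsWeight φ s t v) (hv : IsGroupLikeElem ℂ v) :
    IsGroupLikeElem ℂ (v <• shift φ s) where
  counit_eq_one := by
    rw [counit_op_smul, hv.counit_eq_one, shift, map_add, map_smul, counit_a, counit_b]
    simp
  comul_eq_tmul_self := by
    have orbit_apply (x : SLq φ) : (orbit v).restrictScalars ℂ x = v <• x := rfl
    rw [comul_op_smul hv, op_smul_shift, shift, map_add, map_smul, comul_a, comul_b]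
    simp only [map_add, map_smul, TensorProduct.map_tmul, orbit_apply, h.op_smul_c, h.op_smul_d,
      ← qHalf_mul_self]
    generalize v <• a φ = va, v <• b φ = vb
    simp only [TensorProduct.tmul_add, TensorProduct.add_tmul, TensorProduct.tmul_smul,
      ← TensorProduct.smul_tmul']
    match_scalars <;> ring

end IsWeight

end Weight

section Ladder

theorem q_mul_zpow_mul (φ : ℝ) (n : ℤ) (s : ℂ) : q φ * (q φ ^ n * s) = q φ ^ (n + 1) * s := by
  rw [← mul_assoc, mul_comm (q φ), zpow_add_one₀ (q_ne_zero φ)]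

theorem q_inv_mul_zpow_mul (φ : ℝ) (n : ℤ) (s : ℂ) :
    (q φ)⁻¹ * (q φ ^ n * s) = q φ ^ (n - 1) * s := by
  rw [← mul_assoc, mul_comm (q φ)⁻¹, zpow_sub_one₀ (q_ne_zero φ)]

variable {φ : ℝ} {M N : Type*} [AddCommGroup M] [Module (SLq φ)ᵐᵒᵖ M] [AddCommGroup N]
  [Module (SLq φ)ᵐᵒᵖ N] {s t : ℂ} {v : M} {g g' : ℤ → M}

variable (φ) in
/-- The ladder with a given vector of weight `(s, t)` at position `0`: upwards by the shifts that
raise the first weight, downwards by those that raise the second one. -/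
def ladder (s t : ℂ) (v : M) (n : ℤ) : M :=
  Int.inductionOn' (motive := fun _ => M) n 0 v (fun k _ w => w <• shift φ (q φ ^ k * s))
    fun k _ w => w <• shift φ (q φ ^ (-k) * t)

theorem ladder_zero : ladder φ s t v 0 = v := Int.inductionOn'_self

theorem ladder_add_one_of_nonneg {n : ℤ} (hn : 0 ≤ n) :
    ladder φ s t v (n + 1) = ladder φ s t v n <• shift φ (q φ ^ n * s) :=
  Int.inductionOn'_add_one hn

theorem ladder_sub_one_of_nonpos {n : ℤ} (hn : n ≤ 0) :
    ladder φ s t v (n - 1) = ladder φ s t v n <• shift φ (q φ ^ (-n) * t) :=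
  Int.inductionOn'_sub_one hn

variable [Module ℂ M] [Module ℂ N]

variable (φ) in
/-- A sequence of vectors of weights `(qⁿ s, q⁻ⁿ t)`, each obtained from the previous one by the
shift that raises its first weight. -/
structure IsLadder (s t : ℂ) (g : ℤ → M) : Prop where
  isWeight : ∀ n, IsWeight φ (q φ ^ n * s) (q φ ^ (-n) * t) (g n)
  add_one : ∀ n, g (n + 1) = g n <• shift φ (q φ ^ n * s)

theorem IsLadder.translate (h : IsLadder φ s t g) (m : ℤ) :
    IsLadder φ (q φ ^ m * s) (q φ ^ (-m) * t) fun n => g (n + m) where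
  isWeight n := by
    simpa only [← mul_assoc, ← zpow_add₀ (q_ne_zero φ), neg_add] using h.isWeight (n + m)
  add_one n := by
    simpa only [← mul_assoc, ← zpow_add₀ (q_ne_zero φ), add_right_comm] using h.add_one (n + m)

variable [IsScalarTower ℂ (SLq φ)ᵐᵒᵖ M] [IsScalarTower ℂ (SLq φ)ᵐᵒᵖ N]

theorem IsWeight.map (h : IsWeight φ s t v) (f : M →ₗ[(SLq φ)ᵐᵒᵖ] N) : IsWeight φ s t (f v) where
  op_smul_c := by rw [← map_smul, h.op_smul_c, f.map_smul_of_tower, map_smul]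
  op_smul_d := by
    rw [← map_smul, h.op_smul_d, map_add, f.map_smul_of_tower (qHalf φ * _), map_smul, map_smul]

theorem IsWeight.ladder_apply (h : IsWeight φ s t v) (n : ℤ) :
    IsWeight φ (q φ ^ n * s) (q φ ^ (-n) * t) (ladder φ s t v n) := by
  induction n using Int.inductionOn' (b := 0) with
  | zero => simpa [ladder_zero] using h
  | succ k hk ih =>
    rw [ladder_add_one_of_nonneg hk, neg_add', ← q_mul_zpow_mul, ← q_inv_mul_zpow_mul]
    exact ih.shift_left
  | pred k hk ih =>
    rw [ladder_sub_one_of_nonpos hk, neg_sub', sub_neg_eq_add, ← q_mul_zpow_mul,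
      ← q_inv_mul_zpow_mul]
    exact ih.shift_right

theorem IsWeight.isLadder_ladder (h : IsWeight φ s t v) : IsLadder φ s t (ladder φ s t v) where
  isWeight := h.ladder_apply
  add_one n := by
    obtain hn | hn := le_or_gt 0 n
    · exact ladder_add_one_of_nonneg hn
    · have key := (h.ladder_apply (n + 1)).symm.shift_shift
      rw [← ladder_sub_one_of_nonpos hn, q_inv_mul_zpow_mul, add_sub_cancel_right] at key
      exact key.symm

namespace IsLadder

theorem sub_one (h : IsLadder φ s t g) (n : ℤ) : g (n - 1) = g n <• shift φ (q φ ^ (-n) * t) := by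
  have key := (h.isWeight (n - 1)).shift_shift
  rw [← h.add_one, sub_add_cancel, q_inv_mul_zpow_mul, neg_sub', sub_neg_eq_add,
    add_sub_cancel_right] at key
  exact key.symm

theorem neg (h : IsLadder φ s t g) : IsLadder φ t s fun n => g (-n) where
  isWeight n := by simpa only [neg_neg] using (h.isWeight (-n)).symm
  add_one n := by simpa only [neg_neg, neg_add'] using h.sub_one (-n)

theorem ext (h : IsLadder φ s t g) (h' : IsLadder φ s t g') (h₀ : g 0 = g' 0) : g = g' := by
  funext n
  induction n with
  | zero => exact h₀
  | succ n ih => rw [h.add_one, h'.add_one, ih]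
  | pred n ih => rw [h.sub_one, h'.sub_one, ih]

theorem map (h : IsLadder φ s t g) (f : M →ₗ[(SLq φ)ᵐᵒᵖ] N) : IsLadder φ s t fun n => f (g n) where
  isWeight n := (h.isWeight n).map f
  add_one n := by rw [h.add_one, map_smul]

theorem map_ladder (h : IsLadder φ s t g) (f : N →ₗ[(SLq φ)ᵐᵒᵖ] M) {w : N} {m : ℤ}
    (hw : IsWeight φ (q φ ^ m * s) (q φ ^ (-m) * t) w) (hf : f w = g m) (n : ℤ) :
    f (ladder φ (q φ ^ m * s) (q φ ^ (-m) * t) w n) = g (n + m) :=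
  congr_fun ((hw.isLadder_ladder.map f).ext (h.translate m) (by simpa [ladder_zero] using hf)) n

end IsLadder

end Ladder

section LadderInK

variable {φ μ ν μ' ν' : ℝ} {s t : ℂ} {v : K φ μ ν} {g : ℤ → K φ μ ν}

theorem IsWeight.map_τK (h : IsWeight φ s t v) :
    IsWeight φ (conj s) (conj t) (τK φ μ ν v) := by
  have hq := q_ne_zero φ
  have hc := congr_arg (τK φ μ ν) h.op_smul_c
  have hd := congr_arg (τK φ μ ν) h.op_smul_d
  simp only [τK_op_smul, map_add, LinearMap.map_smulₛₗ, τ_a, τ_b, τ_c, τ_d, op_smul_smul,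
    smul_smul, map_neg, map_mul, conj_q] at hc hd
  constructor
  · rw [← smul_right_inj (neg_ne_zero.2 (inv_ne_zero hq)), hc, smul_smul]
    congr 1
    ring
  · rw [hd, mul_neg, mul_right_comm, conj_qHalf_mul, neg_smul, neg_add_cancel_right]

theorem IsWeight.τK_op_smul_shift (h : IsWeight φ s t v) :
    τK φ μ ν (v <• shift φ s) = τK φ μ ν v <• shift φ (conj t) := by
  rw [τK_op_smul, h.map_τK.op_smul_τ_shift, add_sub_cancel_left]

theorem conj_q_zpow (φ : ℝ) (n : ℤ) : conj (q φ ^ n) = q φ ^ (-n) := by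
  rw [map_zpow₀, conj_q, inv_zpow']

theorem IsLadder.map_τK (h : IsLadder φ s t g) :
    IsLadder φ (conj t) (conj s) fun n => τK φ μ ν (g n) where
  isWeight n := by simpa only [map_mul, conj_q_zpow, neg_neg] using (h.isWeight n).map_τK.symm
  add_one n := by
    rw [h.add_one, (h.isWeight n).τK_op_smul_shift, map_mul, conj_q_zpow, neg_neg]

theorem IsLadder.τK_apply_of_conj (h : IsLadder φ s (conj s) g)
    (h₀ : τK φ μ ν (g 0) = g 0) (n : ℤ) : τK φ μ ν (g n) = g n :=
  congr_fun (ext (by simpa only [Complex.conj_conj] using h.map_τK) h h₀) n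

theorem IsLadder.τK_apply_of_real (h : IsLadder φ s t g) (hs : conj s = s) (ht : conj t = t)
    (h₀ : τK φ μ ν (g 0) = g 0) (n : ℤ) : τK φ μ ν (g n) = g (-n) :=
  congr_fun (ext (by simpa only [hs, ht] using h.map_τK) h.neg (by simpa using h₀)) n

theorem IsLadder.isGroupLikeElem (h : IsLadder φ s t g) (h₀ : IsGroupLikeElem ℂ (g 0)) (n : ℤ) :
    IsGroupLikeElem ℂ (g n) := by
  induction n with
  | zero => exact h₀
  | succ n ih => rw [h.add_one]; exact (h.isWeight _).isGroupLikeElem_shift ih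
  | pred n ih => rw [h.sub_one]; exact (h.isWeight _).symm.isGroupLikeElem_shift ih

end LadderInK

section TranslatedParameters

variable {φ μ ν μ' ν' : ℝ} {s t s' t' : ℂ} {n : ℤ}

theorem q_zpow_mul_eq_iff {φ : ℝ} {n : ℤ} {s s' : ℂ} :
    q φ ^ n * s = s' ↔ q φ ^ (-n) * s' = s := by
  rw [zpow_neg, inv_mul_eq_iff_eq_mul₀ (zpow_ne_zero n (q_ne_zero φ)), eq_comm]

theorem comp_eq_id_of_map_r_one_eq_ladder {f : K φ μ' ν' →ₗ[(SLq φ)ᵐᵒᵖ] K φ μ ν}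
    {g : K φ μ ν →ₗ[(SLq φ)ᵐᵒᵖ] K φ μ' ν'} (h : IsWeight φ s t (r φ μ ν 1))
    (h' : IsWeight φ s' t' (r φ μ' ν' 1)) (hs : q φ ^ n * s = s') (ht : q φ ^ (-n) * t = t')
    (hf : f (r φ μ' ν' 1) = ladder φ s t (r φ μ ν 1) n)
    (hg : g (r φ μ ν 1) = ladder φ s' t' (r φ μ' ν' 1) (-n)) : f ∘ₗ g = LinearMap.id := by
  subst hs ht
  refine K.hom_ext ?_
  rw [LinearMap.comp_apply, hg, h.isLadder_ladder.map_ladder f h' hf, neg_add_cancel, ladder_zero,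
    LinearMap.id_apply]

theorem exists_moduleEquiv_map_r_one_eq_ladder (h₁ : s + t = 2 * μ) (h₂ : s * t = ν)
    (h₁' : s' + t' = 2 * μ') (h₂' : s' * t' = ν') (hs : q φ ^ n * s = s')
    (ht : q φ ^ (-n) * t = t') :
    ∃ e : K φ μ' ν' ≃ₗ[(SLq φ)ᵐᵒᵖ] K φ μ ν,
      e (r φ μ' ν' 1) = ladder φ s t (r φ μ ν 1) n := by
  have w : IsWeight φ s t (r φ μ ν 1) := .r_one h₁ h₂
  have w' : IsWeight φ s' t' (r φ μ' ν' 1) := .r_one h₁' h₂'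
  have u : IsWeight φ s' t' (ladder φ s t (r φ μ ν 1) n) := hs ▸ ht ▸ w.ladder_apply n
  have hs' := q_zpow_mul_eq_iff.1 hs
  have ht' := q_zpow_mul_eq_iff.1 ht
  have u' : IsWeight φ s t (ladder φ s' t' (r φ μ' ν' 1) (-n)) := by
    simpa only [hs', ht'] using w'.ladder_apply (-n)
  have hf := u.lift_r_one h₁' h₂'
  have hg := u'.lift_r_one h₁ h₂
  exact ⟨.ofLinearMap (u.lift h₁' h₂') (u'.lift h₁ h₂)
    (comp_eq_id_of_map_r_one_eq_ladder w w' hs ht hf hg)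
    (comp_eq_id_of_map_r_one_eq_ladder w' w hs' ht' hg (by rwa [neg_neg])), hf⟩

theorem exists_module_realCoalgIso (h₁ : s + conj s = 2 * μ) (h₂ : s * conj s = ν)
    (hs : q φ ^ n * s = s') (h₁' : s' + conj s' = 2 * μ') :
    ∃ e : K φ μ' ν ≃ₗc[ℂ] K φ μ ν,
      (∀ (x : SLq φ) (k : K φ μ' ν), e (k <• x) = e k <• x) ∧
        ∀ k : K φ μ' ν, e (τK φ μ' ν k) = τK φ μ ν (e k) := by
  have ht : q φ ^ (-n) * conj s = conj s' := by rw [← hs, map_mul, conj_q_zpow]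
  have h₂' : s' * conj s' = ν := by
    rw [← ht, ← hs, mul_mul_mul_comm, zpow_neg, mul_inv_cancel₀ (zpow_ne_zero n (q_ne_zero φ)),
      one_mul, h₂]
  obtain ⟨e, he⟩ := exists_moduleEquiv_map_r_one_eq_ladder h₁ h₂ h₁' h₂' hs ht
  have hl : IsLadder φ s (conj s) (ladder φ s (conj s) (r φ μ ν 1)) :=
    (IsWeight.r_one h₁ h₂).isLadder_ladder
  have hgl := hl.isGroupLikeElem (by rw [ladder_zero]; exact isGroupLikeElem_r_one) n
  have hτ := hl.τK_apply_of_conj (by rw [ladder_zero, τK_r_one]) n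
  rw [← he] at hgl hτ
  have he_r (x : SLq φ) : e (r φ μ' ν x) = e (r φ μ' ν 1) <• x := by rw [r_eq_op_smul, map_smul]
  refine ⟨K.coalgEquiv (e.restrictScalars ℂ) (orbitCoalgHom hgl) he_r,
    fun x k => map_smul e _ k, fun k => ?_⟩
  obtain ⟨x, rfl⟩ := r_surjective φ μ' ν k
  change e (τK φ μ' ν (r φ μ' ν x)) = τK φ μ ν (e (r φ μ' ν x))
  rw [τK_r, he_r, he_r x, τK_op_smul, hτ]

theorem q_zpow_mul_q (φ θ : ℝ) (n : ℤ) : q φ ^ n * q θ = q (θ + n * φ) := by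
  simp only [q, ← Complex.exp_int_mul, ← Complex.exp_add]
  push_cast
  ring_nf

theorem smul_q_add_conj (ρ θ : ℝ) : ρ * q θ + conj (ρ * q θ) = 2 * (ρ * Real.cos θ : ℝ) := by
  rw [Complex.add_conj, Complex.re_ofReal_mul, q, Complex.exp_ofReal_mul_I_re]
  push_cast
  ring

theorem smul_q_mul_conj (ρ θ : ℝ) : ρ * q θ * conj (ρ * q θ) = (ρ ^ 2 : ℝ) := by
  rw [map_mul, conj_q, Complex.conj_ofReal, mul_mul_mul_comm, mul_inv_cancel₀ (q_ne_zero θ)]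
  push_cast
  ring

theorem exists_module_realCoalgIso_cos_add (φ : ℝ) {ν : ℝ} (hν : 0 ≤ ν) (θ : ℝ) (n : ℤ) :
    ∃ e : K φ (√ν * Real.cos θ) ν ≃ₗc[ℂ] K φ (√ν * Real.cos (θ + n * φ)) ν,
      (∀ (x : SLq φ) (k : K φ (√ν * Real.cos θ) ν), e (k <• x) = e k <• x) ∧
        ∀ k : K φ (√ν * Real.cos θ) ν, e (τK φ _ ν k) = τK φ _ ν (e k) := by
  refine exists_module_realCoalgIso (s := √ν * q (θ + n * φ)) (n := -n) (smul_q_add_conj _ _) ?_ ?_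
    (smul_q_add_conj _ _)
  · rw [smul_q_mul_conj, Real.sq_sqrt hν]
  · rw [mul_left_comm, q_zpow_mul_q]
    push_cast
    ring_nf

end TranslatedParameters

section RealCoalgIso

variable {A B D : Type*} [AddCommGroup A] [Module ℂ A] [Coalgebra ℂ A] [AddCommGroup B]
  [Module ℂ B] [Coalgebra ℂ B] [AddCommGroup D] [Module ℂ D] [Coalgebra ℂ D]
  {σ : A → A} {ρ : B → B} {π : D → D}

theorem RealCoalgIso.symm : RealCoalgIso σ ρ → RealCoalgIso ρ σ := fun ⟨e, he⟩ =>
  ⟨e.symm, fun x => EquivLike.injective e (by rw [he, e.apply_symm_apply, e.apply_symm_apply])⟩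

theorem RealCoalgIso.trans : RealCoalgIso σ ρ → RealCoalgIso ρ π → RealCoalgIso σ π :=
  fun ⟨e, he⟩ ⟨e', he'⟩ =>
    ⟨e.trans e', fun x => by rw [CoalgEquiv.trans_apply, CoalgEquiv.trans_apply, he, he']⟩

end RealCoalgIso

section Scaling

variable {φ μ ν μ' ν' : ℝ} {u : ℂˣ}

theorem scale_quad (φ : ℝ) (u : ℂˣ) :
    Quad φ (a φ) ((u : ℂ) • b φ) ((u : ℂ)⁻¹ • c φ) (d φ) := by
  have hu := u.ne_zero
  constructor <;>
  simp only [smul_mul_assoc, mul_smul_comm, a_mul_b, a_mul_c, b_mul_d, c_mul_d, d_mul_a, a_mul_d,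
    b_mul_c] <;>
  match_scalars <;> field_simp

/-- The bialgebra automorphism `b ↦ u b`, `c ↦ u⁻¹ c` of `SL_q(2,ℝ)`. -/
def scale (φ : ℝ) (u : ℂˣ) : SLq φ ≃ₐc[ℂ] SLq φ :=
  .ofAlgEquiv
    (.ofAlgHom (lift (scale_quad φ u)) (lift (scale_quad φ u⁻¹))
      (by apply algHom_ext <;> simp [smul_smul])
      (by apply algHom_ext <;> simp [smul_smul]))
    (by apply algHom_ext <;> simp [counit_a, counit_b, counit_c, counit_d])
    (by
      apply algHom_ext <;>
      simp [comul_a, comul_b, comul_c, comul_d, TensorProduct.tmul_smul,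
        ← TensorProduct.smul_tmul', smul_smul])

theorem scale_a : scale φ u (a φ) = a φ := lift_a (scale_quad φ u)

theorem scale_b : scale φ u (b φ) = (u : ℂ) • b φ := lift_b (scale_quad φ u)

theorem scale_c : scale φ u (c φ) = (u : ℂ)⁻¹ • c φ := lift_c (scale_quad φ u)

theorem scale_d : scale φ u (d φ) = d φ := lift_d (scale_quad φ u)

theorem scale_symm_apply (x : SLq φ) : (scale φ u).symm x = scale φ u⁻¹ x := rfl

theorem scale_τ (hu : conj (u : ℂ) = u) (x : SLq φ) :
    scale φ u (τ φ x) = τ φ (scale φ u x) := by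
  induction x using induction with
  | halg z =>
    simp only [Algebra.algebraMap_eq_smul_one, LinearMap.map_smulₛₗ, map_smul, map_one]
    rw [τ_apply, antipode_eq, S_one, star_one, map_one]
  | ha => rw [scale_a, τ_a, scale_d]
  | hb => rw [scale_b, LinearMap.map_smulₛₗ, τ_b, map_smul, scale_b, hu, smul_comm]
  | hc => rw [scale_c, LinearMap.map_smulₛₗ, τ_c, map_smul, scale_c, map_inv₀, hu, smul_comm]
  | hd => rw [scale_d, τ_d, scale_a]
  | hadd x y hx hy => simp only [map_add, hx, hy]
  | hmul x y hx hy => simp only [map_mul, τ_mul, hx, hy]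

theorem scale_mem_R (hμ : u * (μ : ℂ) = μ') (hν : u ^ 2 * (ν : ℂ) = ν') {x : SLq φ}
    (hx : x ∈ R φ μ ν) : scale φ u x ∈ R φ μ' ν' := by
  have hu := u.ne_zero
  have h₁ : scale φ u (coidealGen₁ φ μ) = coidealGen₁ φ μ' := by
    simp only [coidealGen₁, map_add, map_sub, map_smul, scale_a, scale_b, scale_d, ← hμ]
    module
  have h₂ : scale φ u (coidealGen₂ φ ν) = (u : ℂ)⁻¹ • coidealGen₂ φ ν' := by
    simp only [coidealGen₂, map_add, map_smul, scale_b, scale_c, ← hν]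
    match_scalars <;> field_simp
  refine R_induction (P := fun x => scale φ u x ∈ R φ μ' ν') ?_ (fun x y hx hy => ?_)
    (fun y => ?_) (fun y => ?_) hx
  · rw [map_zero]; exact zero_mem _
  · rw [map_add]; exact add_mem hx hy
  · rw [map_mul, h₁]; exact mem_R_mul gen₁_mem _
  · rw [map_mul, h₂]; exact mem_R_mul ((Rℂ φ μ' ν').smul_mem _ gen₂_mem) _

theorem map_scale_R (hμ : u * (μ : ℂ) = μ') (hν : u ^ 2 * (ν : ℂ) = ν') :
    (Rℂ φ μ ν).map (scale φ u).toAlgEquiv.toLinearMap = Rℂ φ μ' ν' := by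
  refine le_antisymm (Submodule.map_le_iff_le_comap.2 fun x hx => scale_mem_R hμ hν hx)
    fun x hx => ⟨(scale φ u).symm x, ?_, (scale φ u).apply_symm_apply x⟩
  rw [scale_symm_apply]
  refine scale_mem_R ?_ ?_ hx
  · rw [← hμ, Units.inv_mul_cancel_left]
  · rw [← hν, ← mul_assoc, ← mul_pow, Units.inv_mul, one_pow, one_mul]

theorem realCoalgIso_of_scale (hu : conj (u : ℂ) = u) (hμ : u * (μ : ℂ) = μ')
    (hν : u ^ 2 * (ν : ℂ) = ν') : RealCoalgIso (τK φ μ ν) (τK φ μ' ν') := by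
  let F : SLq φ →ₗc[ℂ] K φ μ' ν' :=
    (orbitCoalgHom isGroupLikeElem_r_one).comp (scale φ u : SLq φ →ₗc[ℂ] SLq φ)
  let e : K φ μ ν ≃ₗ[ℂ] K φ μ' ν' := Submodule.Quotient.equiv _ _ _ (map_scale_R hμ hν)
  have he (x : SLq φ) : e (r φ μ ν x) = r φ μ' ν' (scale φ u x) := rfl
  refine ⟨K.coalgEquiv e F fun x => (he x).trans (r_eq_op_smul _), fun k => ?_⟩
  obtain ⟨x, rfl⟩ := r_surjective φ μ ν k
  change e (τK φ μ ν (r φ μ ν x)) = τK φ μ' ν' (e (r φ μ ν x))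
  rw [τK_r, he, he, scale_τ hu, τK_r]

theorem realCoalgIso_cos_add (φ : ℝ) (hν : 0 ≤ ν) (θ : ℝ) (n : ℤ) :
    RealCoalgIso (τK φ (√ν * Real.cos θ) ν) (τK φ (√ν * Real.cos (θ + n * φ)) ν) :=
  (exists_module_realCoalgIso_cos_add φ hν θ n).imp fun _ => And.right

theorem realCoalgIso_one_one_of_cos_sq_eq {θ : ℝ} {l : ℤ} (hν : 0 < ν)
    (hθ : Real.cos θ ^ 2 = Real.cos (l * φ) ^ 2) :
    RealCoalgIso (τK φ (√ν * Real.cos θ) ν) (τK φ 1 1) := by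
  have scale_one {ε : ℝ} (hε : ε ^ 2 = 1) : RealCoalgIso (τK φ 1 1) (τK φ (√ν * ε) ν) := by
    have hu : √ν * ε ≠ 0 := mul_ne_zero (Real.sqrt_pos.2 hν).ne' (by rintro rfl; simp at hε)
    refine realCoalgIso_of_scale (u := .mk0 ((√ν * ε : ℝ) : ℂ) (by exact_mod_cast hu))
      (Complex.conj_ofReal _) ?_ ?_
    · rw [Units.val_mk0, Complex.ofReal_one, mul_one]
    · rw [Units.val_mk0, Complex.ofReal_one, mul_one, ← Complex.ofReal_pow, mul_pow,
        Real.sq_sqrt hν.le, hε, mul_one]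
  obtain h | h := sq_eq_sq_iff_eq_or_eq_neg.1 hθ
  · have iso := realCoalgIso_cos_add φ hν.le 0 l
    rw [zero_add, ← h, Real.cos_zero] at iso
    exact ((scale_one (one_pow 2)).trans iso).symm
  · have iso := realCoalgIso_cos_add φ hν.le Real.pi l
    rw [add_comm, Real.cos_add_pi, ← h, Real.cos_pi] at iso
    exact ((scale_one neg_one_sq).trans iso).symm

end Scaling

section LadderModule

variable {φ : ℝ} {s t : ℂ} {n : ℤ}

variable (φ s t) in
/-- The operator `eₙ ↦ F sₙ tₙ eₙ₊₁ + F tₙ sₙ eₙ₋₁` on the space with basis `(eₙ)`, `n ∈ ℤ`, where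
`sₙ = qⁿ s` and `tₙ = q⁻ⁿ t` are the weights at position `n` of a ladder. -/
def ladderStep (F : ℂ → ℂ → ℂ) : Module.End ℂ (ℤ →₀ ℂ) :=
  Finsupp.linearCombination ℂ fun n =>
    F (q φ ^ n * s) (q φ ^ (-n) * t) • .single (n + 1) 1 +
      F (q φ ^ (-n) * t) (q φ ^ n * s) • .single (n - 1) 1

theorem ladderStep_single (F : ℂ → ℂ → ℂ) (n : ℤ) : ladderStep φ s t F (.single n 1) =
    F (q φ ^ n * s) (q φ ^ (-n) * t) • .single (n + 1) 1 +
      F (q φ ^ (-n) * t) (q φ ^ n * s) • .single (n - 1) 1 := by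
  rw [ladderStep, Finsupp.linearCombination_single, one_smul]

theorem ladderStep_ladderStep_single (F G : ℂ → ℂ → ℂ) {x y : ℂ} (hx : q φ ^ n * s = x)
    (hy : q φ ^ (-n) * t = y) : ladderStep φ s t G (ladderStep φ s t F (.single n 1)) =
      (F x y * G (q φ * x) ((q φ)⁻¹ * y)) • .single (n + 2) 1 +
      (F x y * G ((q φ)⁻¹ * y) (q φ * x) + F y x * G ((q φ)⁻¹ * x) (q φ * y)) • .single n 1 +
      (F y x * G (q φ * y) ((q φ)⁻¹ * x)) • .single (n - 2) 1 := by
  subst hx hy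
  simp only [ladderStep_single, map_add, map_smul, q_mul_zpow_mul, q_inv_mul_zpow_mul, neg_add',
    neg_sub', sub_neg_eq_add, add_sub_cancel_right, sub_add_cancel, add_assoc n, sub_sub,
    one_add_one_eq_two]
  module

variable (φ s t) in
/-- The pair `(s, t)` is regular if no two weights at the same position of a ladder starting with
the weight `(s, t)` coincide. -/
def IsRegular : Prop := ∀ n : ℤ, q φ ^ n * s ≠ q φ ^ (-n) * t

theorem IsRegular.exists_weights (h : IsRegular φ s t) (n : ℤ) :
    ∃ x y, q φ ^ n * s = x ∧ q φ ^ (-n) * t = y ∧ s * t = x * y ∧ x ≠ y ∧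
      y ≠ x * qHalf φ ^ 4 ∧ x ≠ y * qHalf φ ^ 4 := by
  have hq := q_ne_zero φ
  have hp : qHalf φ ^ 4 = q φ ^ 2 := by rw [← qHalf_mul_self]; ring
  rw [hp]
  refine ⟨_, _, rfl, rfl, ?_, h n, fun e => h (n + 1) ?_, fun e => h (n - 1) ?_⟩
  · rw [mul_mul_mul_comm, zpow_neg, mul_inv_cancel₀ (zpow_ne_zero n hq), one_mul]
  · rw [neg_add', ← q_mul_zpow_mul, ← q_inv_mul_zpow_mul, e]
    field_simp
  · rw [neg_sub', sub_neg_eq_add, ← q_mul_zpow_mul, ← q_inv_mul_zpow_mul, e]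
    field_simp

theorem quad_ladderStep (h : IsRegular φ s t) :
    Quad φ (MulOpposite.op (ladderStep φ s t fun x y => -y / (x - y)))
      (MulOpposite.op (ladderStep φ s t fun x y => (qHalf φ * (x - y))⁻¹))
      (MulOpposite.op (-(q φ * s * t) • ladderStep φ s t fun x y => (qHalf φ * (x - y))⁻¹))
      (MulOpposite.op (ladderStep φ s t fun x y => x / (x - y))) := by
  have hp := qHalf_ne_zero φ
  constructor
  case bc => rw [MulOpposite.op_smul, mul_smul_comm, smul_mul_assoc]
  all_goals
    apply MulOpposite.unop_injective
    ext1 n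
    ext1
    obtain ⟨x, y, hx, hy, hxy, h₀, h₁, h₂⟩ := h.exists_weights n
    simp only [LinearMap.comp_apply, Finsupp.lsingle_apply, MulOpposite.unop_mul,
      MulOpposite.unop_op, MulOpposite.unop_smul, MulOpposite.unop_add, MulOpposite.unop_one,
      Module.End.mul_apply, LinearMap.smul_apply, LinearMap.add_apply, Module.End.one_apply,
      map_smul, ladderStep_ladderStep_single _ _ hx hy, mul_assoc _ s t, hxy]
    have h₀' := sub_ne_zero.2 h₀
    have h₀'' := sub_ne_zero.2 h₀.symm
    have h₁' := sub_ne_zero.2 h₁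
    have h₁'' := mul_comm x _ ▸ h₁'
    have h₂' := sub_ne_zero.2 h₂
    have h₂'' := mul_comm y _ ▸ h₂'
    simp only [← qHalf_mul_self]
    match_scalars
    all_goals field_simp
    all_goals ring

variable (φ s t) in
/-- The space with basis `(eₙ)`, `n ∈ ℤ`, as a right module over `SL_q(2,ℝ)` in which `(eₙ)` is a
ladder starting with the weight `(s, t)`, for regular `(s, t)`. -/
def LadderModule (_ : IsRegular φ s t) : Type := ℤ →₀ ℂ

namespace LadderModule

variable (h : IsRegular φ s t)

instance : AddCommGroup (LadderModule φ s t h) := inferInstanceAs (AddCommGroup (ℤ →₀ ℂ))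

instance : Module ℂ (LadderModule φ s t h) := inferInstanceAs (Module ℂ (ℤ →₀ ℂ))

/-- The action of `SL_q(2,ℝ)` on `LadderModule`. -/
def action : (SLq φ)ᵐᵒᵖ →ₐ[ℂ] Module.End ℂ (LadderModule φ s t h) :=
  AlgHom.opComm (lift (quad_ladderStep h))

instance : Module (SLq φ)ᵐᵒᵖ (LadderModule φ s t h) := Module.compHom _ (action h).toRingHom

instance : IsScalarTower ℂ (SLq φ)ᵐᵒᵖ (LadderModule φ s t h) where
  smul_assoc z x v := congr($(map_smul (action h) z x) v)

/-- The basis vector `eₙ`. -/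
def e (n : ℤ) : LadderModule φ s t h := Finsupp.single n 1

theorem op_smul_a (v : LadderModule φ s t h) :
    v <• a φ = ladderStep φ s t (fun x y => -y / (x - y)) v :=
  congr(MulOpposite.unop $(lift_a (quad_ladderStep h)) v)

theorem op_smul_b (v : LadderModule φ s t h) :
    v <• b φ = ladderStep φ s t (fun x y => (qHalf φ * (x - y))⁻¹) v :=
  congr(MulOpposite.unop $(lift_b (quad_ladderStep h)) v)

theorem op_smul_c (v : LadderModule φ s t h) : v <• c φ = -(q φ * s * t) • v <• b φ := by
  rw [op_smul_b]
  exact congr(MulOpposite.unop $(lift_c (quad_ladderStep h)) v)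

theorem op_smul_d (v : LadderModule φ s t h) :
    v <• d φ = ladderStep φ s t (fun x y => x / (x - y)) v :=
  congr(MulOpposite.unop $(lift_d (quad_ladderStep h)) v)

theorem ladderStep_e (F : ℂ → ℂ → ℂ) (n : ℤ) : (ladderStep φ s t F (e h n) : LadderModule φ s t h) =
    F (q φ ^ n * s) (q φ ^ (-n) * t) • e h (n + 1) +
      F (q φ ^ (-n) * t) (q φ ^ n * s) • e h (n - 1) :=
  ladderStep_single F n

theorem isLadder_e : IsLadder φ s t (e h) where
  isWeight n := by
    have hp := qHalf_ne_zero φ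
    obtain ⟨x, y, rfl, rfl, hxy, h₀, -⟩ := h.exists_weights n
    have h₀' := sub_ne_zero.2 h₀
    have h₀'' := sub_ne_zero.2 h₀.symm
    constructor
    · rw [op_smul_c, mul_assoc, hxy, mul_assoc (q φ)]
    · rw [op_smul_a, op_smul_b, op_smul_d, ladderStep_e, ladderStep_e, ladderStep_e]
      match_scalars
      all_goals field_simp
      all_goals ring
  add_one n := by
    have hp := qHalf_ne_zero φ
    have h₀ := sub_ne_zero.2 (h n)
    have h₀' := sub_ne_zero.2 (h n).symm
    rw [op_smul_shift, op_smul_a, op_smul_b, ladderStep_e, ladderStep_e]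
    match_scalars
    all_goals field_simp
    all_goals ring

end LadderModule

end LadderModule

section LadderBasis

variable {φ μ ν : ℝ} {s t : ℂ}

theorem linearIndependent_ladder (h : IsRegular φ s t) (h₁ : s + t = 2 * μ) (h₂ : s * t = ν) :
    LinearIndependent ℂ (ladder φ s t (r φ μ ν 1)) := by
  have hw := IsWeight.r_one (φ := φ) h₁ h₂
  have he := LadderModule.isLadder_e h
  have he₀ : IsWeight φ s t (LadderModule.e h 0) := by simpa using he.isWeight 0
  have hf : he₀.lift h₁ h₂ ∘ ladder φ s t (r φ μ ν 1) = LadderModule.e h :=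
    (hw.isLadder_ladder.map (he₀.lift h₁ h₂)).ext he (by rw [ladder_zero, he₀.lift_r_one])
  refine .of_comp ((he₀.lift h₁ h₂).restrictScalars ℂ) ?_
  rw [LinearMap.coe_restrictScalars, hf]
  exact Finsupp.linearIndependent_single_one ℂ ℤ

variable {M : Type*} [AddCommGroup M] [Module ℂ M] [Module (SLq φ)ᵐᵒᵖ M]
  [IsScalarTower ℂ (SLq φ)ᵐᵒᵖ M] {g : ℤ → M} {v : M}

theorem op_smul_mem_span_of_forall {ι : Type*} {g : ι → M} {x : SLq φ}
    (h : ∀ i, g i <• x ∈ Submodule.span ℂ (Set.range g))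
    (hv : v ∈ Submodule.span ℂ (Set.range g)) : v <• x ∈ Submodule.span ℂ (Set.range g) := by
  have key : Submodule.span ℂ (Set.range g) ≤ (Submodule.span ℂ (Set.range g)).comap
      (DistribSMul.toLinearMap ℂ M (MulOpposite.op x)) :=
    Submodule.span_le.2 (Set.range_subset_iff.2 h)
  exact key hv

namespace IsLadder

theorem op_smul_b_mem_span (hg : IsLadder φ s t g) (h : IsRegular φ s t) (n : ℤ) :
    g n <• b φ ∈ Submodule.span ℂ (Set.range g) := by
  have hne := mul_ne_zero (qHalf_ne_zero φ) (sub_ne_zero.2 (h n))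
  rw [← Submodule.smul_mem_iff _ hne, smul_op_smul_b, ← hg.add_one, ← hg.sub_one]
  exact sub_mem (Submodule.subset_span ⟨_, rfl⟩) (Submodule.subset_span ⟨_, rfl⟩)

theorem op_smul_a_mem_span (hg : IsLadder φ s t g) (h : IsRegular φ s t) (n : ℤ) :
    g n <• a φ ∈ Submodule.span ℂ (Set.range g) := by
  rw [← Submodule.smul_mem_iff _ (sub_ne_zero.2 (h n)), smul_op_smul_a, ← hg.add_one, ← hg.sub_one]
  exact sub_mem (Submodule.smul_mem _ _ (Submodule.subset_span ⟨_, rfl⟩))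
    (Submodule.smul_mem _ _ (Submodule.subset_span ⟨_, rfl⟩))

theorem op_smul_mem_span (hg : IsLadder φ s t g) (h : IsRegular φ s t) (x : SLq φ)
    (hv : v ∈ Submodule.span ℂ (Set.range g)) : v <• x ∈ Submodule.span ℂ (Set.range g) := by
  have ha := hg.op_smul_a_mem_span h
  have hb := hg.op_smul_b_mem_span h
  induction x using SLq.induction generalizing v with
  | halg z =>
    rw [Algebra.algebraMap_eq_smul_one, op_smul_smul, MulOpposite.op_one, one_smul]
    exact Submodule.smul_mem _ z hv
  | ha => exact op_smul_mem_span_of_forall ha hv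
  | hb => exact op_smul_mem_span_of_forall hb hv
  | hc =>
    refine op_smul_mem_span_of_forall (fun n => ?_) hv
    rw [(hg.isWeight n).op_smul_c]
    exact Submodule.smul_mem _ _ (hb n)
  | hd =>
    refine op_smul_mem_span_of_forall (fun n => ?_) hv
    rw [(hg.isWeight n).op_smul_d]
    exact add_mem (ha n) (Submodule.smul_mem _ _ (hb n))
  | hadd x y hx hy => exact op_smul_add v x y ▸ add_mem (hx hv) (hy hv)
  | hmul x y hx hy => exact op_smul_op_smul v x y ▸ hy (hx hv)

end IsLadder

theorem span_ladder (h : IsRegular φ s t) (h₁ : s + t = 2 * μ) (h₂ : s * t = ν) :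
    ⊤ ≤ Submodule.span ℂ (Set.range (ladder φ s t (r φ μ ν 1))) := by
  rintro v -
  obtain ⟨x, rfl⟩ := r_surjective φ μ ν v
  have hr := r_eq_op_smul (μ := μ) (ν := ν) x
  rw [hr]
  refine (IsWeight.r_one h₁ h₂).isLadder_ladder.op_smul_mem_span h x (Submodule.subset_span ?_)
  exact ⟨0, ladder_zero⟩

/-- The basis of `K_{μν}` formed by the ladder that starts with the class of `1`. -/
def ladderBasis (h : IsRegular φ s t) (h₁ : s + t = 2 * μ) (h₂ : s * t = ν) :
    Module.Basis ℤ ℂ (K φ μ ν) :=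
  .mk (linearIndependent_ladder h h₁ h₂) (span_ladder h h₁ h₂)

theorem isLadder_ladderBasis (h : IsRegular φ s t) (h₁ : s + t = 2 * μ) (h₂ : s * t = ν) :
    IsLadder φ s t (ladderBasis h h₁ h₂) := by
  rw [ladderBasis, Module.Basis.coe_mk]
  exact (IsWeight.r_one h₁ h₂).isLadder_ladder

theorem ladderBasis_zero (h : IsRegular φ s t) (h₁ : s + t = 2 * μ) (h₂ : s * t = ν) :
    ladderBasis h h₁ h₂ 0 = r φ μ ν 1 := by
  rw [ladderBasis, Module.Basis.mk_apply, ladder_zero]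

end LadderBasis

section GroupLikeBasis

variable {ι R A B : Type*} [CommSemiring R] [AddCommMonoid A] [Module R A] [Coalgebra R A]
  [AddCommMonoid B] [Module R B] [Coalgebra R B]

/-- The isomorphism between two coalgebras that identifies given bases of group-like elements. -/
def coalgEquivOfGroupLikeBasis (b : Module.Basis ι R A) (b' : Module.Basis ι R B)
    (hb : ∀ i, IsGroupLikeElem R (b i)) (hb' : ∀ i, IsGroupLikeElem R (b' i)) : A ≃ₗc[R] B where
  __ := b.equiv b' (.refl ι)
  counit_comp := b.ext fun i => by
    simpa [(hb i).counit_eq_one] using (hb' i).counit_eq_one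
  map_comp_comul := b.ext fun i => by
    simpa [(hb i).comul_eq_tmul_self] using (hb' i).comul_eq_tmul_self.symm

theorem coalgEquivOfGroupLikeBasis_apply (b : Module.Basis ι R A) (b' : Module.Basis ι R B)
    (hb : ∀ i, IsGroupLikeElem R (b i)) (hb' : ∀ i, IsGroupLikeElem R (b' i)) (i : ι) :
    coalgEquivOfGroupLikeBasis b b' hb hb' (b i) = b' i :=
  b.equiv_apply i b' (.refl ι)

end GroupLikeBasis

section Laurent

theorem RealCoalgIso.of_groupLikeBasis {ι A B : Type*} [AddCommGroup A] [Module ℂ A]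
    [Coalgebra ℂ A] [AddCommGroup B] [Module ℂ B] [Coalgebra ℂ B] {b : Module.Basis ι ℂ A}
    {b' : Module.Basis ι ℂ B} {σ : A →ₛₗ[starRingEnd ℂ] A} {ρ : B →ₛₗ[starRingEnd ℂ] B}
    (hb : ∀ i, IsGroupLikeElem ℂ (b i)) (hb' : ∀ i, IsGroupLikeElem ℂ (b' i)) (π : ι → ι)
    (hσ : ∀ i, σ (b i) = b (π i)) (hρ : ∀ i, ρ (b' i) = b' (π i)) : RealCoalgIso σ ρ := by
  let e := coalgEquivOfGroupLikeBasis b b' hb hb'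
  have he := coalgEquivOfGroupLikeBasis_apply b b' hb hb'
  refine ⟨e, fun x => ?_⟩
  have key : (e : A →ₗ[ℂ] B) ∘ₛₗ σ = ρ ∘ₛₗ (e : A →ₗ[ℂ] B) := b.ext fun i => by
    change e (σ (b i)) = ρ (e (b i))
    rw [hσ, he, he, hρ]
  exact LinearMap.congr_fun key x

open LaurentPolynomial

/-- Complex conjugation of the coefficients of a Laurent polynomial. -/
def conjCoeff : ℂ[T;T⁻¹] →ₛₗ[starRingEnd ℂ] ℂ[T;T⁻¹] where
  __ := AddMonoidAlgebra.mapRingHom ℤ (starRingEnd ℂ)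
  map_smul' z f := by
    change AddMonoidAlgebra.mapRingHom ℤ (starRingEnd ℂ) (z • f) = _
    rw [smul_eq_C_mul, map_mul, smul_eq_C_mul]
    congr 1
    exact AddMonoidAlgebra.mapRingHom_single ..

theorem conjCoeff_T (n : ℤ) : conjCoeff (T n) = T n :=
  (AddMonoidAlgebra.mapRingHom_single ..).trans (by rw [map_one, T])

theorem τRPlus_T (n : ℤ) : τRPlus (T n) = T (-n) := by
  rw [τRPlus, antipode_T]
  exact conjCoeff_T (-n)

theorem τS1_T (n : ℤ) : τS1 (T n) = T n := by
  rw [τS1, antipode_T]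
  exact (congr_arg invert (conjCoeff_T (-n))).trans (by rw [invert_T, neg_neg])

variable {φ μ ν : ℝ} {s t : ℂ}

theorem isGroupLikeElem_ladderBasis (h : IsRegular φ s t) (h₁ : s + t = 2 * μ) (h₂ : s * t = ν)
    (n : ℤ) : IsGroupLikeElem ℂ (ladderBasis h h₁ h₂ n) :=
  (isLadder_ladderBasis h h₁ h₂).isGroupLikeElem
    (by rw [ladderBasis_zero]; exact isGroupLikeElem_r_one) n

theorem realCoalgIso_τRPlus (h : IsRegular φ s t) (h₁ : s + t = 2 * μ) (h₂ : s * t = ν)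
    (hs : conj s = s) (ht : conj t = t) : RealCoalgIso (τK φ μ ν) τRPlus :=
  RealCoalgIso.of_groupLikeBasis (b := ladderBasis h h₁ h₂) (b' := AddMonoidAlgebra.basis ℤ ℂ)
    (ρ := conjCoeff ∘ₛₗ HopfAlgebra.antipode ℂ) (isGroupLikeElem_ladderBasis h h₁ h₂)
    AddMonoidAlgebra.isGroupLikeElem_single_one (fun n => -n)
    ((isLadder_ladderBasis h h₁ h₂).τK_apply_of_real hs ht (by rw [ladderBasis_zero, τK_r_one]))
    τRPlus_T

theorem realCoalgIso_τS1 (h : IsRegular φ s (conj s)) (h₁ : s + conj s = 2 * μ)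
    (h₂ : s * conj s = ν) : RealCoalgIso (τK φ μ ν) τS1 :=
  RealCoalgIso.of_groupLikeBasis (b := ladderBasis h h₁ h₂) (b' := AddMonoidAlgebra.basis ℤ ℂ)
    (ρ := (invert (R := ℂ)).toLinearMap ∘ₛₗ conjCoeff ∘ₛₗ HopfAlgebra.antipode ℂ)
    (isGroupLikeElem_ladderBasis h h₁ h₂) AddMonoidAlgebra.isGroupLikeElem_single_one id
    ((isLadder_ladderBasis h h₁ h₂).τK_apply_of_conj (by rw [ladderBasis_zero, τK_r_one])) τS1_T

end Laurent

section Parameters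

variable {φ μ ν : ℝ}

theorem q_zpow_ne_neg_one (hq : ∀ n : ℕ, 0 < n → q φ ^ n ≠ 1) (n : ℤ) : q φ ^ n ≠ -1 := by
  intro h
  have h₂ : q φ ^ (2 * n) = 1 := by rw [two_mul, zpow_add₀ (q_ne_zero φ), h, neg_one_mul, neg_neg]
  obtain rfl | hn := eq_or_ne n 0
  · norm_num at h
  · refine hq (2 * n).natAbs (by omega) ?_
    rw [← zpow_natCast]
    obtain h' | h' := abs_choice (2 * n) <;> rw [Int.natCast_natAbs, h']
    · exact h₂
    · rw [zpow_neg, h₂, inv_one]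

theorem isRegular_ofReal {s t : ℝ} (hst : s ≠ t)
    (h : s + t = 0 → ∀ n : ℤ, q φ ^ (2 * n) ≠ -1) : IsRegular φ s t := by
  intro n hn
  have norm_q_zpow (m : ℤ) : ‖q φ ^ m‖ = 1 := by
    rw [norm_zpow, q, Complex.norm_exp_ofReal_mul_I, one_zpow]
  have habs := congr_arg norm hn
  rw [norm_mul, norm_mul, norm_q_zpow, norm_q_zpow, one_mul, one_mul, Complex.norm_real,
    Complex.norm_real, Real.norm_eq_abs, Real.norm_eq_abs, abs_eq_abs] at habs
  obtain rfl := habs.resolve_left hst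
  refine h (neg_add_cancel t) n ?_
  have ht : (t : ℂ) ≠ 0 := fun ht => hst (by rw [Complex.ofReal_eq_zero.1 ht, neg_zero])
  rw [Complex.ofReal_neg, mul_neg, ← neg_mul, mul_left_inj' ht, neg_eq_iff_eq_neg, zpow_neg] at hn
  rw [two_mul, zpow_add₀ (q_ne_zero φ)]
  nth_rw 1 [hn]
  rw [neg_mul, inv_mul_cancel₀ (zpow_ne_zero n (q_ne_zero φ))]

theorem isRegular_of_cos_sq_ne {ρ θ : ℝ} (hρ : ρ ≠ 0)
    (hθ : ∀ l : ℤ, Real.cos θ ^ 2 ≠ Real.cos (l * φ) ^ 2) :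
    IsRegular φ (ρ * q θ) (conj (ρ * q θ)) := by
  intro n hn
  rw [← conj_q_zpow, ← map_mul, mul_left_comm, q_zpow_mul_q, eq_comm, Complex.conj_eq_iff_im,
    Complex.im_ofReal_mul, q, Complex.exp_ofReal_mul_I_im] at hn
  obtain ⟨k, hk⟩ := Real.sin_eq_zero_iff.1 ((mul_eq_zero.1 hn).resolve_left hρ)
  refine hθ n ?_
  rw [eq_sub_of_add_eq hk.symm, Real.cos_int_mul_pi_sub, mul_pow, ← sq_abs ((-1) ^ k),
    abs_neg_one_zpow, one_pow, one_mul]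

theorem realCoalgIso_τRPlus_of_lt (hμν : ν < μ ^ 2) (h : μ = 0 → ∀ n : ℤ, q φ ^ (2 * n) ≠ -1) :
    RealCoalgIso (τK φ μ ν) τRPlus := by
  have hw : 0 < √(μ ^ 2 - ν) := Real.sqrt_pos.2 (sub_pos.2 hμν)
  have hw₂ := Real.sq_sqrt (sub_pos.2 hμν).le
  refine realCoalgIso_τRPlus (s := (μ + √(μ ^ 2 - ν) : ℝ)) (t := (μ - √(μ ^ 2 - ν) : ℝ))
    (isRegular_ofReal (by linarith) fun h₀ => h (by linarith)) ?_ ?_ (Complex.conj_ofReal _)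
    (Complex.conj_ofReal _)
  · push_cast
    ring
  · rw [← Complex.ofReal_mul]
    congr 1
    linear_combination -hw₂

theorem realCoalgIso_τS1_of_cos_sq_ne {θ : ℝ} (hν : 0 < ν)
    (hθ : ∀ l : ℤ, Real.cos θ ^ 2 ≠ Real.cos (l * φ) ^ 2) :
    RealCoalgIso (τK φ (√ν * Real.cos θ) ν) τS1 :=
  realCoalgIso_τS1 (isRegular_of_cos_sq_ne (Real.sqrt_pos.2 hν).ne' hθ) (smul_q_add_conj _ _)
    (by rw [smul_q_mul_conj, Real.sq_sqrt hν.le])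

end Parameters

end QuantumSL2

end

theorem mainTheorem2_general (φ : ℝ) :
    (∀ μ ν : ℝ, ν < μ ^ 2 → (μ = 0 → ∀ n : ℤ, QuantumSL2.q φ ^ (2 * n) ≠ -1) →
      QuantumSL2.RealCoalgIso (QuantumSL2.τK φ μ ν) QuantumSL2.τRPlus) ∧
    (∀ μ ν θ : ℝ, 0 < ν → μ / √ν = Real.cos θ →
      (∀ l : ℤ, Real.cos θ ^ 2 ≠ Real.cos (l * φ) ^ 2) →
        QuantumSL2.RealCoalgIso (QuantumSL2.τK φ μ ν) QuantumSL2.τS1) ∧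
    (∀ (μ ν θ μ' ν' θ' : ℝ) (l l' : ℤ),
      0 < ν → μ / √ν = Real.cos θ → Real.cos θ ^ 2 = Real.cos (l * φ) ^ 2 →
      0 < ν' → μ' / √ν' = Real.cos θ' → Real.cos θ' ^ 2 = Real.cos (l' * φ) ^ 2 →
      QuantumSL2.RealCoalgIso (QuantumSL2.τK φ μ ν) (QuantumSL2.τK φ μ' ν')) ∧
    (∀ (μ ν θ μn : ℝ) (n : ℤ),
      0 < ν → μ / √ν = Real.cos θ → μn / √ν = Real.cos (θ + n * φ) →
      ∃ e : QuantumSL2.K φ μ ν ≃ₗc[ℂ] QuantumSL2.K φ μn ν,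
        (∀ (x : QuantumSL2.SLq φ) (k : QuantumSL2.K φ μ ν),
          e (MulOpposite.op x • k) = MulOpposite.op x • e k) ∧
        ∀ k : QuantumSL2.K φ μ ν, e (QuantumSL2.τK φ μ ν k) = QuantumSL2.τK φ μn ν (e k)) := by
  have eq_mul {μ ν x : ℝ} (hν : 0 < ν) (h : μ / √ν = x) : μ = √ν * x := by
    rw [← h, mul_div_cancel₀ _ (Real.sqrt_pos.2 hν).ne']
  refine ⟨fun μ ν => QuantumSL2.realCoalgIso_τRPlus_of_lt, ?_, ?_, ?_⟩
  · intro μ ν θ hν hμ hθ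
    rw [eq_mul hν hμ]
    exact QuantumSL2.realCoalgIso_τS1_of_cos_sq_ne hν hθ
  · intro μ ν θ μ' ν' θ' l l' hν hμ hθ hν' hμ' hθ'
    rw [eq_mul hν hμ, eq_mul hν' hμ']
    exact (QuantumSL2.realCoalgIso_one_one_of_cos_sq_eq hν hθ).trans
      (QuantumSL2.realCoalgIso_one_one_of_cos_sq_eq hν' hθ').symm
  · intro μ ν θ μn n hν hμ hμn
    rw [eq_mul hν hμ, eq_mul hν hμn]
    exact QuantumSL2.exists_module_realCoalgIso_cos_add φ hν.le θ n

theorem mainTheorem2 (φ : ℝ) (hq : ∀ n : ℕ, 0 < n → QuantumSL2.q φ ^ n ≠ 1) :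
    -- (i), `ℝ_+` type
    (∀ μ ν : ℝ, ν < μ ^ 2 → QuantumSL2.RealCoalgIso (QuantumSL2.τK φ μ ν) QuantumSL2.τRPlus) ∧
    -- (i), `S¹` type
    (∀ μ ν θ : ℝ, 0 < ν → μ / √ν = Real.cos θ →
      (∀ l : ℤ, Real.cos θ ^ 2 ≠ Real.cos (l * φ) ^ 2) → QuantumSL2.RealCoalgIso (QuantumSL2.τK φ μ ν) QuantumSL2.τS1) ∧
    -- (i), special series
    (∀ (μ ν θ μ' ν' θ' : ℝ) (l l' : ℤ),
      0 < ν → μ / √ν = Real.cos θ → Real.cos θ ^ 2 = Real.cos (l * φ) ^ 2 →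
      0 < ν' → μ' / √ν' = Real.cos θ' → Real.cos θ' ^ 2 = Real.cos (l' * φ) ^ 2 →
      QuantumSL2.RealCoalgIso (QuantumSL2.τK φ μ ν) (QuantumSL2.τK φ μ' ν')) ∧
    -- (ii)
    (∀ (μ ν θ μn : ℝ) (n : ℤ),
      0 < ν → μ / √ν = Real.cos θ → μn / √ν = Real.cos (θ + n * φ) →
      ∃ e : QuantumSL2.K φ μ ν ≃ₗc[ℂ] QuantumSL2.K φ μn ν,
        (∀ (x : QuantumSL2.SLq φ) (k : QuantumSL2.K φ μ ν), e (MulOpposite.op x • k) = MulOpposite.op x • e k) ∧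
        ∀ k : QuantumSL2.K φ μ ν, e (QuantumSL2.τK φ μ ν k) = QuantumSL2.τK φ μn ν (e k)) :=
  ⟨fun _ _ h => (mainTheorem2_general φ).1 _ _ h fun _ _ => QuantumSL2.q_zpow_ne_neg_one hq _,
    (mainTheorem2_general φ).2⟩
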